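/- Fix $T>0$. A function $u:[0,T]\to\mathbb R$ is \emph{regulated} if it has finite left limits $u(s-)$ for $s\in(0,T]$ and finite right limits $u(s+)$ for $s\in[0,T)$; write $\Delta^-u(s)=u(s)-u(s-)$ and $\Delta^+u(s)=u(s+)-u(s)$. Let $W_2^*=W_2^*([0,T])$ be the set of regulated $u$ with $$\sigma_2(u):=\sum_{s\in(0,T]}|\Delta^-u(s)|^2+\sum_{s\in[0,T)}|\Delta^+u(s)|^2<\infty$$ such that for every $\epsilon>0$ there is a partition $\lambda$ of $[0,T]$ with $$\Bigl|\sum_{i=1}^n|u(s_i)-u(s_{i-1})|^2-\sigma_2(u)\Bigr|<\epsilon$$ for all refinements $\{0=s_0<s_1<\dots<s_n=T\}$ of $\lambda$. For $f,r:[0,T]\to\mathbb R$, the Henstock--Kurzweil integral $\int_0^T f(s)\,dr(s)$ exists and equals $I\in\mathbb R$ if for every $\epsilon>0$ there is $\delta:[0,T]\to(0,\infty)$ such that $\bigl|\sum_{i=1}^n f(y_i)(r(s_i)-r(s_{i-1}))-I\bigr|<\epsilon$ for all $0=s_0<\dots<s_n=T$ and all tags $y_i$ with $y_i-\delta(y_i)\le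 s_{i-1}\le y_i\le s_i\le y_i+\delta(y_i)$, $i=1,\dots,n$. \textbf{Theorem.} Let $u_1\in W_2^*([0,T])$, let $u_2:[0,T]\to\mathbb R$ be of bounded variation, and put $u=(u_1,u_2)$ and $S_i=[\inf_{[0,T]}u_i,\ \sup_{[0,T]}u_i]$ for $i=1,2$. Let $G\in C^1(S_1\times S_2;\mathbb R)$ (that is, the partial derivatives, one-sided at the boundary, exist and are continuous on $S_1\times S_2$; in a direction in which the rectangle degenerates to a point, the partial derivative may be taken to be any continuous function). Suppose there are a constant $K_1\ge0$ and a continuous function $K:S_1\times S_2\times S_2\to[0,\infty)$ with $K(x_1,x_2,x_2)=0$ and $$\Bigl|\tfrac{\partial G}{\partial x_1}(x_1,x_2)-\tfrac{\partial G}{\partial x_1}(y_1,x_2)\Bigr|\le K_1|x_1-y_1|,\qquad \Bigl|\tfrac{\partial G}{\partial x_1}(x_1,x_2)-\tfrac{\partial G}{\partial x_1}(x_1,y_2)\Bigr|\le K(x_1,x_2,y_2)\,|x_2-y_2|^{1/2}$$ for all $x_1,y_1\in S_1$ and $x_2,y_2\in S_2$. Then $\int_0^T\frac{\partial G}{\partial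 x_1}(u(s))\,du_1(s)$ exists as a Henstock--Kurzweil integral, $\int_0^T\frac{\partial G}{\partial x_2}(u(s))\,du_2(s)$ exists both as a Lebesgue--Stieltjes integral over $[0,T]$ and as a Henstock--Kurzweil integral, with the same value, and \begin{align*} G(u(T))-G(u(0))={}&\int_0^T\tfrac{\partial G}{\partial x_1}(u(s))\,du_1(s)+\int_0^T\tfrac{\partial G}{\partial x_2}(u(s))\,du_2(s)\\ &+\sum_{s\in(0,T]}\Bigl(G(u(s))-G(u(s-))-\tfrac{\partial G}{\partial x_1}(u(s))\Delta^-u_1(s)-\tfrac{\partial G}{\partial x_2}(u(s))\Delta^-u_2(s)\Bigr)\\ &+\sum_{s\in[0,T)}\Bigl(G(u(s+))-G(u(s))-\tfrac{\partial G}{\partial x_1}(u(s))\Delta^+u_1(s)-\tfrac{\partial G}{\partial x_2}(u(s))\Delta^+u_2(s)\Bigr), \end{align*} where both sums converge absolutely. Here the Lebesgue--Stieltjes integral is taken with respect to the signed measure $\mu$ on $[0,T]$ given by $\mu([0,t])=u_2(t+)-u_2(0)$ for $0\le t<T$ and $\mu([0,T])=u_2(T)-u_2(0)$. -/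

import Mathlib

open Set Filter Topology MeasureTheory

noncomputable section

namespace HKChainRule

/-- A partition `0 = s₀ < s₁ < ⋯ < sₙ = T` of `[0,T]` (the values `pt i`, `i > n`, play no role). -/
structure IntervalPartition (T : ℝ) where
  n : ℕ
  pt : ℕ → ℝ
  pt_zero : pt 0 = 0
  pt_last : pt n = T
  pt_lt : ∀ i < n, pt i < pt (i + 1)

/-- The set `{s₀, …, sₙ}` of division points. -/
def IntervalPartition.points {T : ℝ} (κ : IntervalPartition T) : Set ℝ := κ.pt '' Iic κ.n

/-- `κ` is a refinement of `l`. -/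
def IntervalPartition.Refines {T : ℝ} (κ l : IntervalPartition T) : Prop := l.points ⊆ κ.points

/-- A tagged partition `{([s_{i-1}, s_i], y_i)}`: the `i`-th tag lies in the closed interval
`[pt i, pt (i+1)]`. -/
structure TaggedPartition (T : ℝ) extends IntervalPartition T where
  tag : ℕ → ℝ
  tag_mem : ∀ i < n, tag i ∈ Icc (pt i) (pt (i + 1))

/-- `δ`-fineness of a tagged partition. -/
def TaggedPartition.IsFine {T : ℝ} (τ : TaggedPartition T) (δ : ℝ → ℝ) : Prop :=
  ∀ i < τ.n, τ.tag i - δ (τ.tag i) ≤ τ.pt i ∧ τ.pt (i + 1) ≤ τ.tag i + δ (τ.tag i)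

/-- The Riemann–Stieltjes sum of `f` with respect to `r` along `τ`. -/
def riemannSum {T : ℝ} (f r : ℝ → ℝ) (τ : TaggedPartition T) : ℝ :=
  ∑ i ∈ Finset.range τ.n, f (τ.tag i) * (r (τ.pt (i + 1)) - r (τ.pt i))

/-- The Henstock–Kurzweil integral `∫_0^T f dr` exists and equals `I`. -/
def HasHKIntegral (T : ℝ) (f r : ℝ → ℝ) (I : ℝ) : Prop :=
  ∀ ε > 0, ∃ δ : ℝ → ℝ, (∀ s ∈ Icc 0 T, 0 < δ s) ∧
    ∀ τ : TaggedPartition T, τ.IsFine δ → |riemannSum f r τ - I| < ε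

/-- `u` is regulated on `[0,T]`: it has finite left limits on `(0,T]` and finite right limits on
`[0,T)`. -/
def IsRegulated (T : ℝ) (u : ℝ → ℝ) : Prop :=
  (∀ s ∈ Ioc 0 T, ∃ l, Tendsto u (𝓝[<] s) (𝓝 l)) ∧
  (∀ s ∈ Ico 0 T, ∃ l, Tendsto u (𝓝[>] s) (𝓝 l))

/-- `Δ⁻u(s) = u(s) - u(s-)`. -/
def leftJump (u : ℝ → ℝ) (s : ℝ) : ℝ := u s - Function.leftLim u s

/-- `Δ⁺u(s) = u(s+) - u(s)`. -/
def rightJump (u : ℝ → ℝ) (s : ℝ) : ℝ := Function.rightLim u s - u s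

/-- `σ₂(u)`, the sum of the squares of all one-sided jumps on `[0,T]`. -/
def sigmaTwo (T : ℝ) (u : ℝ → ℝ) : ℝ :=
  ∑' s : Ioc 0 T, |leftJump u s| ^ 2 + ∑' s : Ico 0 T, |rightJump u s| ^ 2

/-- The class `W₂^*([0,T])`: regulated functions with `σ₂(u) < ∞` whose quadratic variation sums
converge to `σ₂(u)` under refinement of partitions. -/
structure MemW2Star (T : ℝ) (u : ℝ → ℝ) : Prop where
  regulated : IsRegulated T u
  summable_left : Summable fun s : Ioc 0 T => |leftJump u s| ^ 2
  summable_right : Summable fun s : Ico 0 T => |rightJump u s| ^ 2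
  tendsto_sigmaTwo : ∀ ε > 0, ∃ l : IntervalPartition T, ∀ κ : IntervalPartition T, κ.Refines l →
    |(∑ i ∈ Finset.range κ.n, |u (κ.pt (i + 1)) - u (κ.pt i)| ^ 2) - sigmaTwo T u| < ε

/-- The closed interval `[inf_{[0,T]} u, sup_{[0,T]} u]`. -/
def rangeInterval (T : ℝ) (u : ℝ → ℝ) : Set ℝ := Icc (sInf (u '' Icc 0 T)) (sSup (u '' Icc 0 T))

/-- `G` is continuously differentiable on the rectangle `A × B` with partial derivatives
`∂G/∂x₁ = G₁` and `∂G/∂x₂ = G₂` (one-sided at the boundary). They are determined by `G` unless `A`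
or `B` is a single point; a partial derivative in such a degenerate direction
may be any continuous function. -/
structure IsC1On (G G₁ G₂ : ℝ × ℝ → ℝ) (A B : Set ℝ) : Prop where
  hasDeriv₁ : ∀ x ∈ A, ∀ y ∈ B, HasDerivWithinAt (fun x' => G (x', y)) (G₁ (x, y)) A x
  hasDeriv₂ : ∀ x ∈ A, ∀ y ∈ B, HasDerivWithinAt (fun y' => G (x, y')) (G₂ (x, y)) B y
  continuousOn₁ : ContinuousOn G₁ (A ×ˢ B)
  continuousOn₂ : ContinuousOn G₂ (A ×ˢ B)

/-- The extension of `u|_{[0,T]}` to the real line that is constant on `(-∞,0]` and on `[T,∞)`. -/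
def constExtend (T : ℝ) (hT : 0 ≤ T) (u : ℝ → ℝ) : ℝ → ℝ := fun s => u (projIcc 0 T hT s)

theorem boundedVariationOn_constExtend {T : ℝ} (hT : 0 ≤ T) {u : ℝ → ℝ}
    (hu : BoundedVariationOn u (Icc 0 T)) : BoundedVariationOn (constExtend T hT u) univ :=
  ne_top_of_le_ne_top hu <|
    eVariationOn.comp_le_of_monotoneOn u (fun s => (projIcc 0 T hT s : ℝ))
      (fun _ _ _ _ h => monotone_projIcc hT h) (fun s _ => (projIcc 0 T hT s).2)

/-- The signed Lebesgue–Stieltjes measure `μ_u` of a function `u` of bounded variation on `[0,T]`: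
`μ_u([0,t]) = u(t+) - u(0)` for `0 ≤ t < T`, `μ_u([0,T]) = u(T) - u(0)`, and no mass outside
`[0,T]`. -/
def lsMeasure {T : ℝ} (hT : 0 ≤ T) {u : ℝ → ℝ} (hu : BoundedVariationOn u (Icc 0 T)) :
    SignedMeasure ℝ :=
  (boundedVariationOn_constExtend hT hu).vectorMeasure

/-- The Lebesgue–Stieltjes integral `∫_{[0,T]} f dμ_u` exists and equals `I`. -/
def HasLSIntegral {T : ℝ} (hT : 0 ≤ T) {u : ℝ → ℝ} (hu : BoundedVariationOn u (Icc 0 T))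
    (f : ℝ → ℝ) (I : ℝ) : Prop :=
  (lsMeasure hT hu).IntegrableOn f (Icc 0 T) ∧ ∫ᵛ s in Icc 0 T, f s ∂•(lsMeasure hT hu) = I

/-- The correction term at a jump from the left:
`G(u(s)) - G(u(s-)) - G₁(u(s)) Δ⁻u₁(s) - G₂(u(s)) Δ⁻u₂(s)`. -/
def leftCorrection (G G₁ G₂ : ℝ × ℝ → ℝ) (u₁ u₂ : ℝ → ℝ) (s : ℝ) : ℝ :=
  G (u₁ s, u₂ s) - G (Function.leftLim u₁ s, Function.leftLim u₂ s)
    - G₁ (u₁ s, u₂ s) * leftJump u₁ s - G₂ (u₁ s, u₂ s) * leftJump u₂ s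

/-- The correction term at a jump from the right:
`G(u(s+)) - G(u(s)) - G₁(u(s)) Δ⁺u₁(s) - G₂(u(s)) Δ⁺u₂(s)`. -/
def rightCorrection (G G₁ G₂ : ℝ × ℝ → ℝ) (u₁ u₂ : ℝ → ℝ) (s : ℝ) : ℝ :=
  G (Function.rightLim u₁ s, Function.rightLim u₂ s) - G (u₁ s, u₂ s)
    - G₁ (u₁ s, u₂ s) * rightJump u₁ s - G₂ (u₁ s, u₂ s) * rightJump u₂ s

end HKChainRule

end

/-!
Write `u = (u₁, u₂)` and let `Ψ y s = G (u s) - G (u y) - G₁ (u y) (u₁ s - u₁ y) -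
G₂ (u y) (u₂ s - u₂ y)` be the first-order Taylor remainder at the tag `y`. For a tagged partition
with division points `sᵢ` and tags `yᵢ`, the sum of `Ψ yᵢ sᵢ - Ψ yᵢ sᵢ₋₁` is
`G (u T) - G (u 0)` minus the two Riemann sums, and the correction terms of the formula are, up to
sign, the one-sided limits of `Ψ y` at `y`. So the chain rule says that these sums of increments
converge to the sum of the one-sided limits.

This is an instance of a statement about interval functions, `exists_gauge_abs_sum_sub_lt`, whose
main hypothesis is that `|Ψ y s| ≤ L (u₁ s - u₁ y)² + ε |V s - V y|` for `s` near `y`, with finitely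
many exceptions `y` for every `ε`; here `V` is monotone. The gauge is chosen so that every point of
a large finite set `F` has to be a tag. The intervals at the points of `F` then contribute the
one-sided limits there. All other intervals contribute little: the quadratic sums of `u₁` are close
to the sum of its squared jumps, which is almost exhausted by the jumps at `F`.

For the Taylor remainder the bound is `IsC1On.abs_taylorRemainder_le`: the Lipschitz condition on
`G₁` yields the square, and the mean value theorem in the second variable yields
the oscillation of `G₂` near `u y`, which is small unless `u` has a large jump at `y`
(`IsRegulated.exists_finite`), times the increment of `u₂`.

The same statement, with `L = 0` and vanishing limits, identifies the Lebesgue–Stieltjes integral of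
a regulated function with its Henstock–Kurzweil integral (`IsRegulated.exists_integral`): there `Ψ`
is the difference between `f y (w s - w y)` and the increment of the primitive `lsPrimitive`.
-/

noncomputable section

namespace HKChainRule

/-! ### Partitions -/

theorem IntervalPartition.pt_mono {T : ℝ} (κ : IntervalPartition T) {i j : ℕ} (hij : i ≤ j)
    (hj : j ≤ κ.n) : κ.pt i ≤ κ.pt j := by
  induction j, hij using Nat.le_induction with
  | base => exact le_rfl
  | succ k hk ih => exact (ih (by omega)).trans (κ.pt_lt k (by omega)).le

theorem IntervalPartition.pt_mem_Icc {T : ℝ} (κ : IntervalPartition T) {i : ℕ} (hi : i ≤ κ.n) :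
    κ.pt i ∈ Icc 0 T :=
  ⟨by simpa [κ.pt_zero] using κ.pt_mono (Nat.zero_le i) hi,
    by simpa [κ.pt_last] using κ.pt_mono hi le_rfl⟩

theorem TaggedPartition.tag_mem_Icc {T : ℝ} (τ : TaggedPartition T) {i : ℕ} (hi : i < τ.n) :
    τ.tag i ∈ Icc 0 T :=
  ⟨(τ.pt_mem_Icc hi.le).1.trans (τ.tag_mem i hi).1,
    (τ.tag_mem i hi).2.trans (τ.pt_mem_Icc (Nat.succ_le_of_lt hi)).2⟩

theorem IntervalPartition.finite_points {T : ℝ} (κ : IntervalPartition T) : κ.points.Finite :=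
  (finite_Iic _).image _

theorem IntervalPartition.points_subset {T : ℝ} (κ : IntervalPartition T) :
    κ.points ⊆ Icc 0 T := by
  rintro _ ⟨i, hi, rfl⟩
  exact κ.pt_mem_Icc hi

/-- Every point of `(0,T]` lies in one of the half-open intervals `(s_{i-1}, s_i]`. -/
theorem IntervalPartition.exists_mem_Ioc {T : ℝ} (κ : IntervalPartition T) {x : ℝ}
    (hx : x ∈ Ioc 0 T) : ∃ i < κ.n, x ∈ Ioc (κ.pt i) (κ.pt (i + 1)) := by
  classical
  have hex : ∃ j, x ≤ κ.pt j := ⟨κ.n, by simpa [κ.pt_last] using hx.2⟩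
  have hle : Nat.find hex ≤ κ.n := Nat.find_le (by simpa [κ.pt_last] using hx.2)
  have hspec := Nat.find_spec hex
  obtain ⟨k, hk⟩ : ∃ k, Nat.find hex = k + 1 := by
    refine Nat.exists_eq_succ_of_ne_zero fun h => ?_
    rw [h, κ.pt_zero] at hspec
    exact absurd hx.1 (not_lt.2 hspec)
  refine ⟨k, by omega, lt_of_not_ge fun h => ?_, hk ▸ hspec⟩
  exact Nat.find_min hex (by omega) h

/-- Every point of `[0,T)` lies in one of the half-open intervals `[s_{i-1}, s_i)`. -/
theorem IntervalPartition.exists_mem_Ico {T : ℝ} (κ : IntervalPartition T) {x : ℝ}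
    (hx : x ∈ Ico 0 T) : ∃ i < κ.n, x ∈ Ico (κ.pt i) (κ.pt (i + 1)) := by
  classical
  have hex : ∃ j, x < κ.pt j := ⟨κ.n, by simpa [κ.pt_last] using hx.2⟩
  have hle : Nat.find hex ≤ κ.n := Nat.find_le (by simpa [κ.pt_last] using hx.2)
  have hspec := Nat.find_spec hex
  obtain ⟨k, hk⟩ : ∃ k, Nat.find hex = k + 1 := by
    refine Nat.exists_eq_succ_of_ne_zero fun h => ?_
    rw [h, κ.pt_zero] at hspec
    exact absurd hx.1 (not_le.2 hspec)
  refine ⟨k, by omega, le_of_not_gt fun h => ?_, hk ▸ hspec⟩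
  exact Nat.find_min hex (by omega) h

/-- Deleting repetitions from a weakly increasing sequence of division points changes neither the
set of points nor sums of an interval function which vanishes on degenerate intervals. -/
theorem exists_intervalPartition_of_monotone (m : ℕ) (p : ℕ → ℝ) (h0 : p 0 = 0)
    (hp : ∀ j < m, p j ≤ p (j + 1)) (T : ℝ) (hT : p m = T) :
    ∃ κ : IntervalPartition T, κ.points = p '' Iic m ∧
      ∀ φ : ℝ → ℝ → ℝ, (∀ x, φ x x = 0) →
        ∑ i ∈ Finset.range κ.n, φ (κ.pt i) (κ.pt (i + 1)) =
          ∑ j ∈ Finset.range m, φ (p j) (p (j + 1)) := by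
  induction m generalizing T with
  | zero =>
    refine ⟨⟨0, p, h0, hT, by simp⟩, rfl, fun φ _ => by simp⟩
  | succ m ih =>
    obtain ⟨κ, hκ, hsum⟩ := ih (fun j hj => hp j (by omega)) (p m) rfl
    have himg : p '' Iic (m + 1) = insert (p (m + 1)) (p '' Iic m) := by
      rw [← image_insert_eq]
      congr 1
      ext k
      simp only [mem_Iic, mem_insert_iff]
      omega
    rcases (hp m (by omega)).eq_or_lt with heq | hlt
    · have himg' : p '' Iic (m + 1) = κ.points := by
        rw [himg, ← heq, insert_eq_of_mem (mem_image_of_mem p (mem_Iic.2 le_rfl)), hκ]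
      have hzero : ∀ φ : ℝ → ℝ → ℝ, (∀ x, φ x x = 0) → φ (p m) (p (m + 1)) = 0 := by
        intro φ hφ
        rw [← heq, hφ]
      refine ⟨⟨κ.n, κ.pt, κ.pt_zero, by rw [κ.pt_last, heq, hT], κ.pt_lt⟩, himg'.symm,
        fun φ hφ => ?_⟩
      rw [Finset.sum_range_succ, hzero φ hφ, add_zero]
      exact hsum φ hφ
    · have himg' : p '' Iic (m + 1) = insert T κ.points := by rw [himg, hκ, hT]
      refine ⟨⟨κ.n + 1, fun i => if i ≤ κ.n then κ.pt i else T, by simp [κ.pt_zero], by simp,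
        fun i hi => ?_⟩, ?_, fun φ hφ => ?_⟩
      · rcases (Nat.lt_succ_iff.1 hi).eq_or_lt with rfl | hi'
        · simpa [κ.pt_last, ← hT] using hlt
        · simpa [hi'.le, Nat.succ_le_of_lt hi'] using κ.pt_lt i hi'
      · rw [himg']
        ext x
        constructor
        · rintro ⟨i, hi, rfl⟩
          by_cases h : i ≤ κ.n
          · right
            exact ⟨i, h, by simp [h]⟩
          · left
            simp [h]
        · rintro (rfl | ⟨i, hi, rfl⟩)
          · exact ⟨κ.n + 1, by simp, by simp⟩
          · exact ⟨i, Nat.le_succ_of_le hi, by simp [mem_Iic.1 hi]⟩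
      · rw [Finset.sum_range_succ, Finset.sum_range_succ, ← hsum φ hφ]
        congr 1
        · refine Finset.sum_congr rfl fun i hi => ?_
          have hi := Finset.mem_range.1 hi
          simp [hi.le, Nat.succ_le_of_lt hi]
        · simp [κ.pt_last, hT]

/-- The defining property of `W₂^*`, with the quadratic sums formed along a tagged partition each
of whose intervals is cut at its tag. -/
theorem MemW2Star.exists_finite_forall_tagged {T : ℝ} {u : ℝ → ℝ} (hu : MemW2Star T u) {ε : ℝ}
    (hε : 0 < ε) : ∃ P : Set ℝ, P.Finite ∧ P ⊆ Icc 0 T ∧ ∀ τ : TaggedPartition T,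
      (∀ x ∈ P, (∃ i ≤ τ.n, τ.pt i = x) ∨ ∃ i < τ.n, τ.tag i = x) →
      |(∑ i ∈ Finset.range τ.n, ((u (τ.tag i) - u (τ.pt i)) ^ 2 +
        (u (τ.pt (i + 1)) - u (τ.tag i)) ^ 2)) - sigmaTwo T u| < ε := by
  obtain ⟨l, hl⟩ := hu.tendsto_sigmaTwo ε hε
  refine ⟨l.points, l.finite_points, l.points_subset, fun τ hτ => ?_⟩
  -- The cut partition lists division points at even indices and tags at odd ones.
  set p : ℕ → ℝ := fun j => if j % 2 = 0 then τ.pt (j / 2) else τ.tag (j / 2) with hp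
  have peven : ∀ i, p (2 * i) = τ.pt i := fun i => by simp [hp]
  have podd : ∀ i, p (2 * i + 1) = τ.tag i := fun i => by
    have h1 : (2 * i + 1) % 2 = 1 := by omega
    have h2 : (2 * i + 1) / 2 = i := by omega
    simp [hp, h1, h2]
  obtain ⟨κ, hκ, hsum⟩ := exists_intervalPartition_of_monotone (2 * τ.n) p
    (by simpa [τ.pt_zero] using peven 0) (fun j hj => by
      obtain ⟨i, rfl | rfl⟩ := Nat.even_or_odd' j
      · rw [peven, podd]
        exact (τ.tag_mem i (by omega)).1
      · rw [podd, show 2 * i + 1 + 1 = 2 * (i + 1) by ring, peven]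
        exact (τ.tag_mem i (by omega)).2) T (by rw [peven, τ.pt_last])
  have href : κ.Refines l := by
    intro x hx
    rw [hκ]
    rcases hτ x hx with ⟨i, hi, rfl⟩ | ⟨i, hi, rfl⟩
    · exact ⟨2 * i, by simp only [mem_Iic]; omega, peven i⟩
    · exact ⟨2 * i + 1, by simp only [mem_Iic]; omega, podd i⟩
  have h2 : ∀ n, ∑ j ∈ Finset.range (2 * n), |u (p (j + 1)) - u (p j)| ^ 2 =
      ∑ i ∈ Finset.range n, ((u (τ.tag i) - u (τ.pt i)) ^ 2 +
        (u (τ.pt (i + 1)) - u (τ.tag i)) ^ 2) := by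
    intro n
    induction n with
    | zero => simp
    | succ n ih =>
      rw [show 2 * (n + 1) = 2 * n + 1 + 1 by ring, Finset.sum_range_succ, Finset.sum_range_succ,
        Finset.sum_range_succ _ n, ih, show 2 * n + 1 + 1 = 2 * (n + 1) by ring, peven, podd, peven,
        sq_abs, sq_abs, add_assoc]
  have := hl κ href
  rwa [hsum (fun x y => |u y - u x| ^ 2) (by simp), h2] at this

/-- A pointwise local condition on `[0,T]` can be enforced by a gauge. -/
theorem exists_gauge {T : ℝ} {Q : ℝ → ℝ → Prop}
    (hQ : ∀ y ∈ Icc 0 T, ∀ᶠ s in 𝓝[Icc 0 T] y, Q y s) :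
    ∃ δ : ℝ → ℝ, (∀ s ∈ Icc 0 T, 0 < δ s) ∧ ∀ τ : TaggedPartition T, τ.IsFine δ →
      ∀ i < τ.n, Q (τ.tag i) (τ.pt i) ∧ Q (τ.tag i) (τ.pt (i + 1)) := by
  have h : ∀ y, ∃ d : ℝ, y ∈ Icc 0 T → 0 < d ∧ ∀ s ∈ Icc 0 T, |s - y| ≤ d → Q y s := by
    intro y
    by_cases hy : y ∈ Icc 0 T
    · obtain ⟨d, hd, hball⟩ := Metric.mem_nhdsWithin_iff.1 (hQ y hy)
      refine ⟨d / 2, fun _ => ⟨half_pos hd, fun s hs hsy => hball ⟨?_, hs⟩⟩⟩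
      rw [Metric.mem_ball, Real.dist_eq]
      linarith
    · exact ⟨0, fun h => absurd h hy⟩
  choose δ hδ using h
  refine ⟨δ, fun s hs => (hδ s hs).1, fun τ hτ i hi => ?_⟩
  have ht := τ.tag_mem_Icc hi
  have hf := hτ i hi
  have hm := τ.tag_mem i hi
  exact ⟨(hδ _ ht).2 _ (τ.pt_mem_Icc hi.le)
      (abs_le.2 ⟨by linarith, by linarith [hm.1, (hδ _ ht).1]⟩),
    (hδ _ ht).2 _ (τ.pt_mem_Icc (Nat.succ_le_of_lt hi))
      (abs_le.2 ⟨by linarith [hm.2, (hδ _ ht).1], by linarith⟩)⟩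

theorem TaggedPartition.IsFine.mono {T : ℝ} {τ : TaggedPartition T} {δ δ' : ℝ → ℝ}
    (h : τ.IsFine δ) (hδ : ∀ s, δ s ≤ δ' s) : τ.IsFine δ' := fun i hi =>
  ⟨by linarith [(h i hi).1, hδ (τ.tag i)], by linarith [(h i hi).2, hδ (τ.tag i)]⟩

/-- The tagged partition *forces* the points of the finite set `F` to be tags: a point of `F` lies
in one of the closed intervals of the partition only as the tag of that interval. -/
def TaggedPartition.Forces {T : ℝ} (τ : TaggedPartition T) (F : Finset ℝ) : Prop :=
  ∀ i < τ.n, ∀ f ∈ F, f ∈ Icc (τ.pt i) (τ.pt (i + 1)) → f = τ.tag i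

/-- Each point of `F` in `(0,T]` is the tag of exactly one interval that extends to its left. -/
theorem TaggedPartition.Forces.sum_left {T : ℝ} {τ : TaggedPartition T} {F : Finset ℝ}
    (h : τ.Forces F) (g : ℝ → ℝ) [DecidablePred (· ∈ Ioc 0 T)] :
    ∑ i ∈ Finset.range τ.n, (if τ.tag i ∈ F ∧ τ.pt i < τ.tag i then g (τ.tag i) else 0) =
      ∑ f ∈ F with f ∈ Ioc 0 T, g f := by
  rw [← Finset.sum_filter]
  refine Finset.sum_bij (fun i _ => τ.tag i) (fun i hi => ?_) (fun i hi j hj hij => ?_)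
    (fun f hf => ?_) (fun _ _ => rfl)
  · simp only [Finset.mem_filter, Finset.mem_range] at hi ⊢
    exact ⟨hi.2.1, (τ.pt_mem_Icc hi.1.le).1.trans_lt hi.2.2, (τ.tag_mem_Icc hi.1).2⟩
  · simp only [Finset.mem_filter, Finset.mem_range] at hi hj
    by_contra hne
    rcases lt_or_gt_of_ne hne with hlt | hlt
    · have := τ.pt_mono (Nat.succ_le_of_lt hlt) hj.1.le
      linarith [(τ.tag_mem i hi.1).2, hj.2.2]
    · have := τ.pt_mono (Nat.succ_le_of_lt hlt) hi.1.le
      linarith [(τ.tag_mem j hj.1).2, hi.2.2]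
  · simp only [Finset.mem_filter] at hf
    obtain ⟨i, hi, hfi⟩ := τ.exists_mem_Ioc hf.2
    have := h i hi f hf.1 (Ioc_subset_Icc_self hfi)
    refine ⟨i, ?_, this.symm⟩
    simp only [Finset.mem_filter, Finset.mem_range]
    exact ⟨hi, this ▸ hf.1, this ▸ hfi.1⟩

/-- Each point of `F` in `[0,T)` is the tag of exactly one interval that extends to its right. -/
theorem TaggedPartition.Forces.sum_right {T : ℝ} {τ : TaggedPartition T} {F : Finset ℝ}
    (h : τ.Forces F) (g : ℝ → ℝ) [DecidablePred (· ∈ Ico 0 T)] :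
    ∑ i ∈ Finset.range τ.n, (if τ.tag i ∈ F ∧ τ.tag i < τ.pt (i + 1) then g (τ.tag i) else 0) =
      ∑ f ∈ F with f ∈ Ico 0 T, g f := by
  rw [← Finset.sum_filter]
  refine Finset.sum_bij (fun i _ => τ.tag i) (fun i hi => ?_) (fun i hi j hj hij => ?_)
    (fun f hf => ?_) (fun _ _ => rfl)
  · simp only [Finset.mem_filter, Finset.mem_range] at hi ⊢
    exact ⟨hi.2.1, (τ.tag_mem_Icc hi.1).1,
      hi.2.2.trans_le (τ.pt_mem_Icc (Nat.succ_le_of_lt hi.1)).2⟩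
  · simp only [Finset.mem_filter, Finset.mem_range] at hi hj
    by_contra hne
    rcases lt_or_gt_of_ne hne with hlt | hlt
    · have := τ.pt_mono (Nat.succ_le_of_lt hlt) hj.1.le
      linarith [(τ.tag_mem j hj.1).1, hi.2.2]
    · have := τ.pt_mono (Nat.succ_le_of_lt hlt) hi.1.le
      linarith [(τ.tag_mem i hi.1).1, hj.2.2]
  · simp only [Finset.mem_filter] at hf
    obtain ⟨i, hi, hfi⟩ := τ.exists_mem_Ico hf.2
    have := h i hi f hf.1 (Ico_subset_Icc_self hfi)
    refine ⟨i, ?_, this.symm⟩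
    simp only [Finset.mem_filter, Finset.mem_range]
    exact ⟨hi, this ▸ hf.1, this ▸ hfi.2⟩

theorem exists_finset_abs_sum_sub_tsum_lt {S : Set ℝ} {f : ℝ → ℝ}
    (hf : Summable fun s : S => f s) {ε : ℝ} (hε : 0 < ε) [DecidablePred (· ∈ S)] :
    ∃ F₀ : Finset ℝ, ∀ F, F₀ ⊆ F → |(∑ x ∈ F with x ∈ S, f x) - ∑' s : S, f s| < ε := by
  have hs : Summable (S.indicator f) := summable_subtype_iff_indicator.1 hf
  have h := hs.hasSum
  rw [← tsum_subtype] at h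
  obtain ⟨F₀, hF₀⟩ := Metric.tendsto_atTop.1 h ε hε
  refine ⟨F₀, fun F hF => ?_⟩
  have := hF₀ F hF
  rw [Real.dist_eq] at this
  have hsum : ∑ x ∈ F with x ∈ S, f x = ∑ x ∈ F, S.indicator f x := by
    rw [Finset.sum_filter]
    exact Finset.sum_congr rfl fun x _ => by simp [indicator_apply]
  rwa [hsum]

/-! ### Sums of interval functions along fine tagged partitions -/

/-- The condition imposed by the gauge on a tag `y` and an endpoint `s` of its interval. If `y`
belongs to the exceptional set `F`, then `Ψ y s` is close to the one-sided limit of `Ψ y` at `y`,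
and the squared increment of `u` is almost as large as the squared jump; otherwise `Ψ y s` is
controlled by the increments of `u` and `V`. Moreover, every point of `F` other than `y` is farther
from `y` than `s` is. -/
structure GoodPair (F : Finset ℝ) (u V : ℝ → ℝ) (L ε η : ℝ) (Ψ : ℝ → ℝ → ℝ) (cl cr : ℝ → ℝ)
    (y s : ℝ) : Prop where
  sep : ∀ f ∈ F, f ≠ y → |s - y| < |f - y|
  bound : y ∉ F → |Ψ y s| ≤ L * (u s - u y) ^ 2 + ε * |V s - V y|
  left : y ∈ F → s < y → |Ψ y s + cl y| ≤ η ∧ |leftJump u y| ^ 2 - η ≤ (u y - u s) ^ 2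
  right : y ∈ F → y < s → |Ψ y s - cr y| ≤ η ∧ |rightJump u y| ^ 2 - η ≤ (u s - u y) ^ 2

theorem eventually_goodPair {T : ℝ} {u V : ℝ → ℝ} (hu : IsRegulated T u) {F : Finset ℝ}
    {L ε η : ℝ} (hη : 0 < η) {Ψ : ℝ → ℝ → ℝ} {cl cr : ℝ → ℝ}
    (hcl : ∀ y ∈ Ioc 0 T, Tendsto (Ψ y) (𝓝[<] y) (𝓝 (-cl y)))
    (hcr : ∀ y ∈ Ico 0 T, Tendsto (Ψ y) (𝓝[>] y) (𝓝 (cr y))) {y : ℝ} (hy : y ∈ Icc 0 T)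
    (hloc : y ∉ F → ∀ᶠ s in 𝓝[Icc 0 T] y, |Ψ y s| ≤ L * (u s - u y) ^ 2 + ε * |V s - V y|) :
    ∀ᶠ s in 𝓝[Icc 0 T] y, GoodPair F u V L ε η Ψ cl cr y s := by
  have hsep : ∀ᶠ s in 𝓝[Icc 0 T] y, ∀ f ∈ F, f ≠ y → |s - y| < |f - y| := by
    refine nhdsWithin_le_nhds ((Finset.eventually_all F).2 fun f _ => ?_)
    by_cases hf : f = y
    · exact Eventually.of_forall fun _ h => absurd hf h
    · have hpos : 0 < |f - y| := abs_pos.2 (sub_ne_zero.2 hf)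
      filter_upwards [Metric.ball_mem_nhds y hpos] with s hs _
      rwa [Metric.mem_ball, Real.dist_eq] at hs
  have hbound : ∀ᶠ s in 𝓝[Icc 0 T] y,
      y ∉ F → |Ψ y s| ≤ L * (u s - u y) ^ 2 + ε * |V s - V y| := by
    by_cases hF : y ∈ F
    · exact Eventually.of_forall fun _ h => absurd hF h
    · filter_upwards [hloc hF] with s hs _ using hs
  have hleft : ∀ᶠ s in 𝓝[Icc 0 T] y,
      s < y → |Ψ y s + cl y| ≤ η ∧ |leftJump u y| ^ 2 - η ≤ (u y - u s) ^ 2 := by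
    rcases hy.1.eq_or_lt with h0 | h0
    · filter_upwards [self_mem_nhdsWithin] with s hs hsy
      exact absurd (hs.1.trans_lt hsy) (by rw [h0]; exact lt_irrefl _)
    · have hul := tendsto_leftLim_of_tendsto (hu.1 y ⟨h0, hy.2⟩)
      have h1 := ((hcl y ⟨h0, hy.2⟩).add_const (cl y)).abs
      have h2 := (hul.const_sub (u y)).pow 2
      rw [neg_add_cancel, abs_zero] at h1
      have h3 : ∀ᶠ s in 𝓝[<] y, |Ψ y s + cl y| ≤ η ∧
          |leftJump u y| ^ 2 - η ≤ (u y - u s) ^ 2 := by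
        refine (h1.eventually (ge_mem_nhds hη)).and (h2.eventually (le_mem_nhds ?_))
        rw [sq_abs, leftJump]
        linarith
      exact nhdsWithin_le_nhds (eventually_nhdsWithin_iff.1 h3)
  have hright : ∀ᶠ s in 𝓝[Icc 0 T] y,
      y < s → |Ψ y s - cr y| ≤ η ∧ |rightJump u y| ^ 2 - η ≤ (u s - u y) ^ 2 := by
    rcases hy.2.eq_or_lt with h0 | h0
    · filter_upwards [self_mem_nhdsWithin] with s hs hsy
      exact absurd (hsy.trans_le hs.2) (by rw [h0]; exact lt_irrefl _)
    · have hul := tendsto_rightLim_of_tendsto (hu.2 y ⟨hy.1, h0⟩)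
      have h1 := ((hcr y ⟨hy.1, h0⟩).sub_const (cr y)).abs
      have h2 := (hul.sub_const (u y)).pow 2
      rw [sub_self, abs_zero] at h1
      have h3 : ∀ᶠ s in 𝓝[>] y, |Ψ y s - cr y| ≤ η ∧
          |rightJump u y| ^ 2 - η ≤ (u s - u y) ^ 2 := by
        refine (h1.eventually (ge_mem_nhds hη)).and (h2.eventually (le_mem_nhds ?_))
        rw [sq_abs, rightJump]
        linarith
      exact nhdsWithin_le_nhds (eventually_nhdsWithin_iff.1 h3)
  filter_upwards [hsep, hbound, hleft, hright] with s h1 h2 h3 h4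
  exact ⟨h1, h2, fun _ => h3, fun _ => h4⟩

theorem forces_of_goodPair {T : ℝ} {F : Finset ℝ} {u V : ℝ → ℝ} {L ε η : ℝ} {Ψ : ℝ → ℝ → ℝ}
    {cl cr : ℝ → ℝ} {τ : TaggedPartition T}
    (hτ : ∀ i < τ.n, GoodPair F u V L ε η Ψ cl cr (τ.tag i) (τ.pt i) ∧
      GoodPair F u V L ε η Ψ cl cr (τ.tag i) (τ.pt (i + 1))) : τ.Forces F := by
  intro i hi f hf hfI
  by_contra hne
  have hm := τ.tag_mem i hi
  rcases lt_or_gt_of_ne hne with hlt | hlt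
  · have := (hτ i hi).1.sep f hf hne
    rw [abs_of_nonpos (by linarith [hm.1]), abs_of_nonpos (by linarith)] at this
    linarith [hfI.1]
  · have := (hτ i hi).2.sep f hf hne
    rw [abs_of_nonneg (by linarith [hm.2]), abs_of_nonneg (by linarith)] at this
    linarith [hfI.2]

/-- The estimate for a single tagged partition: up to the error terms on the right, the sum of the
increments of `Ψ` consists of the one-sided limits of `Ψ` at the points of `F`. -/
theorem abs_sum_sub_sum_le {T : ℝ} {F : Finset ℝ} {u V : ℝ → ℝ} {L ε η : ℝ}
    (hV : MonotoneOn V (Icc 0 T)) (hL : 0 ≤ L) (hε : 0 ≤ ε) (hη : 0 ≤ η)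
    {Ψ : ℝ → ℝ → ℝ} (hΨ : ∀ y, Ψ y y = 0) {cl cr : ℝ → ℝ} {τ : TaggedPartition T}
    (hτ : ∀ i < τ.n, GoodPair F u V L ε η Ψ cl cr (τ.tag i) (τ.pt i) ∧
      GoodPair F u V L ε η Ψ cl cr (τ.tag i) (τ.pt (i + 1)))
    [DecidablePred (· ∈ Ioc 0 T)] [DecidablePred (· ∈ Ico 0 T)] :
    |(∑ i ∈ Finset.range τ.n, (Ψ (τ.tag i) (τ.pt (i + 1)) - Ψ (τ.tag i) (τ.pt i))) -
        (∑ f ∈ F with f ∈ Ioc 0 T, cl f) - ∑ f ∈ F with f ∈ Ico 0 T, cr f| ≤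
      L * ((∑ i ∈ Finset.range τ.n, ((u (τ.tag i) - u (τ.pt i)) ^ 2 +
          (u (τ.pt (i + 1)) - u (τ.tag i)) ^ 2)) -
        (∑ f ∈ F with f ∈ Ioc 0 T, |leftJump u f| ^ 2) -
        (∑ f ∈ F with f ∈ Ico 0 T, |rightJump u f| ^ 2) + 2 * F.card * η) +
      ε * (V T - V 0) + 2 * F.card * η := by
  have hforce := forces_of_goodPair hτ
  -- `χl i`, `χr i` record whether the left, right part of the `i`-th interval is a genuine
  -- interval ending at a point of `F`.
  set χl : (ℝ → ℝ) → ℕ → ℝ := fun g i =>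
    if τ.tag i ∈ F ∧ τ.pt i < τ.tag i then g (τ.tag i) else 0 with hχl
  set χr : (ℝ → ℝ) → ℕ → ℝ := fun g i =>
    if τ.tag i ∈ F ∧ τ.tag i < τ.pt (i + 1) then g (τ.tag i) else 0 with hχr
  have hsuml : ∀ g, ∑ i ∈ Finset.range τ.n, χl g i = ∑ f ∈ F with f ∈ Ioc 0 T, g f :=
    fun g => hforce.sum_left g
  have hsumr : ∀ g, ∑ i ∈ Finset.range τ.n, χr g i = ∑ f ∈ F with f ∈ Ico 0 T, g f :=
    fun g => hforce.sum_right g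
  have hptl : ∀ i < τ.n, |-Ψ (τ.tag i) (τ.pt i) - χl cl i| ≤
      L * ((u (τ.tag i) - u (τ.pt i)) ^ 2 - χl (fun f => |leftJump u f| ^ 2) i + χl (fun _ => η) i)
        + ε * (V (τ.tag i) - V (τ.pt i)) + χl (fun _ => η) i := by
    intro i hi
    have hm := (τ.tag_mem i hi).1
    have hVm : 0 ≤ V (τ.tag i) - V (τ.pt i) :=
      sub_nonneg.2 (hV (τ.pt_mem_Icc hi.le) (τ.tag_mem_Icc hi) hm)
    by_cases hF : τ.tag i ∈ F
    · rcases hm.eq_or_lt with heq | hlt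
      · simp [hχl, heq, hΨ]
      · obtain ⟨h1, h2⟩ := (hτ i hi).1.left hF hlt
        simp only [hχl, hF, hlt, and_self, if_true]
        rw [← abs_neg, show -(-Ψ (τ.tag i) (τ.pt i) - cl (τ.tag i)) =
          Ψ (τ.tag i) (τ.pt i) + cl (τ.tag i) by ring]
        have h3 := mul_nonneg hL (sub_nonneg.2 h2)
        have h4 := mul_nonneg hε hVm
        linarith
    · have := (hτ i hi).1.bound hF
      rw [abs_sub_comm (V (τ.pt i)), abs_of_nonneg hVm] at this
      simp only [hχl, hF, false_and, if_false]
      rw [sub_zero, abs_neg, sub_zero, add_zero, add_zero,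
        ← neg_sub (u (τ.pt i)), neg_sq]
      exact this
  have hptr : ∀ i < τ.n, |Ψ (τ.tag i) (τ.pt (i + 1)) - χr cr i| ≤
      L * ((u (τ.pt (i + 1)) - u (τ.tag i)) ^ 2 - χr (fun f => |rightJump u f| ^ 2) i +
        χr (fun _ => η) i)
        + ε * (V (τ.pt (i + 1)) - V (τ.tag i)) + χr (fun _ => η) i := by
    intro i hi
    have hm := (τ.tag_mem i hi).2
    have hVm : 0 ≤ V (τ.pt (i + 1)) - V (τ.tag i) :=
      sub_nonneg.2 (hV (τ.tag_mem_Icc hi) (τ.pt_mem_Icc (Nat.succ_le_of_lt hi)) hm)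
    by_cases hF : τ.tag i ∈ F
    · rcases hm.eq_or_lt with heq | hlt
      · simp [hχr, ← heq, hΨ]
      · obtain ⟨h1, h2⟩ := (hτ i hi).2.right hF hlt
        simp only [hχr, hF, hlt, and_self, if_true]
        have h3 := mul_nonneg hL (sub_nonneg.2 h2)
        have h4 := mul_nonneg hε hVm
        linarith
    · have := (hτ i hi).2.bound hF
      rw [abs_of_nonneg hVm] at this
      simp only [hχr, hF, false_and, if_false]
      rw [sub_zero, sub_zero, add_zero, add_zero]
      exact this
  have hcardl : ∑ i ∈ Finset.range τ.n, χl (fun _ => η) i ≤ F.card * η := by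
    refine (hsuml fun _ => η).le.trans ?_
    rw [Finset.sum_const, nsmul_eq_mul]
    gcongr
    exact Finset.filter_subset _ _
  have hcardr : ∑ i ∈ Finset.range τ.n, χr (fun _ => η) i ≤ F.card * η := by
    refine (hsumr fun _ => η).le.trans ?_
    rw [Finset.sum_const, nsmul_eq_mul]
    gcongr
    exact Finset.filter_subset _ _
  have hVsum : ∑ i ∈ Finset.range τ.n, (V (τ.tag i) - V (τ.pt i)) +
      ∑ i ∈ Finset.range τ.n, (V (τ.pt (i + 1)) - V (τ.tag i)) = V T - V 0 := by
    have htel := Finset.sum_range_sub (fun i => V (τ.pt i)) τ.n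
    rw [τ.pt_zero, τ.pt_last] at htel
    rw [← Finset.sum_add_distrib, ← htel]
    exact Finset.sum_congr rfl fun i _ => by ring
  have hl := (Finset.abs_sum_le_sum_abs _ _).trans
    (Finset.sum_le_sum fun i hi => hptl i (Finset.mem_range.1 hi))
  have hr := (Finset.abs_sum_le_sum_abs _ _).trans
    (Finset.sum_le_sum fun i hi => hptr i (Finset.mem_range.1 hi))
  simp only [Finset.sum_add_distrib, Finset.sum_sub_distrib, ← Finset.mul_sum,
    Finset.sum_neg_distrib] at hl hr hVsum ⊢
  rw [hsuml cl, hsuml fun f => |leftJump u f| ^ 2] at hl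
  rw [hsumr cr, hsumr fun f => |rightJump u f| ^ 2] at hr
  have habs := abs_add_le
    (-∑ i ∈ Finset.range τ.n, Ψ (τ.tag i) (τ.pt i) - ∑ f ∈ F with f ∈ Ioc 0 T, cl f)
    ((∑ i ∈ Finset.range τ.n, Ψ (τ.tag i) (τ.pt (i + 1))) - ∑ f ∈ F with f ∈ Ico 0 T, cr f)
  have hLl := mul_le_mul_of_nonneg_left hcardl hL
  have hLr := mul_le_mul_of_nonneg_left hcardr hL
  rw [← hVsum]
  refine le_trans (le_of_eq ?_) (habs.trans ((add_le_add hl hr).trans ?_))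
  · congr 1
    ring
  · linarith

/-- Let `Ψ y` have one-sided limits `-cl y` and `cr y` at `y`, with `cl` and `cr` summable, and
suppose that, apart from finitely many `y` for each `ε`, `Ψ y s` is bounded by
`L (u s - u y)² + ε |V s - V y|` for `s` near `y`. As the quadratic variation of `u ∈ W₂^*` is
concentrated in the jumps, the sums of the increments of `Ψ` along fine tagged partitions converge
to the sum of the one-sided limits. -/
theorem exists_gauge_abs_sum_sub_lt {T : ℝ} (hT : 0 ≤ T) {u : ℝ → ℝ} (hu : MemW2Star T u)
    {V : ℝ → ℝ} (hV : MonotoneOn V (Icc 0 T)) {L : ℝ} (hL : 0 ≤ L) {Ψ : ℝ → ℝ → ℝ}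
    (hΨ : ∀ y, Ψ y y = 0) {cl cr : ℝ → ℝ}
    (hcl : ∀ y ∈ Ioc 0 T, Tendsto (Ψ y) (𝓝[<] y) (𝓝 (-cl y)))
    (hcr : ∀ y ∈ Ico 0 T, Tendsto (Ψ y) (𝓝[>] y) (𝓝 (cr y)))
    (hsl : Summable fun s : Ioc 0 T => cl s) (hsr : Summable fun s : Ico 0 T => cr s)
    (hloc : ∀ ε > 0, ∃ F : Set ℝ, F.Finite ∧ ∀ y ∈ Icc 0 T, y ∉ F → ∀ᶠ s in 𝓝[Icc 0 T] y,
      |Ψ y s| ≤ L * (u s - u y) ^ 2 + ε * |V s - V y|) {ε : ℝ} (hε : 0 < ε) :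
    ∃ δ : ℝ → ℝ, (∀ s ∈ Icc 0 T, 0 < δ s) ∧ ∀ τ : TaggedPartition T, τ.IsFine δ →
      |(∑ i ∈ Finset.range τ.n, (Ψ (τ.tag i) (τ.pt (i + 1)) - Ψ (τ.tag i) (τ.pt i))) -
        (∑' s : Ioc 0 T, cl s + ∑' s : Ico 0 T, cr s)| < ε := by
  classical
  have hVT : 0 ≤ V T - V 0 := sub_nonneg.2 (hV ⟨le_rfl, hT⟩ ⟨hT, le_rfl⟩ hT)
  -- The squares contribute at most `4 * L * a`, the three remaining error terms of size `a` come
  -- from the cardinality of `F` and from the two truncated series.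
  set a : ℝ := ε / (2 * (4 * L + 4)) with ha
  set b : ℝ := ε / (2 * (V T - V 0 + 1)) with hb
  have ha0 : 0 < a := by positivity
  have hb0 : 0 < b := by positivity
  have haε : a * (4 * L + 4) = ε / 2 := by rw [ha]; field_simp
  have hbε : b * (V T - V 0 + 1) = ε / 2 := by rw [hb]; field_simp
  obtain ⟨P, hPfin, hPsub, hP⟩ := hu.exists_finite_forall_tagged ha0
  obtain ⟨F₀, hF₀fin, hF₀⟩ := hloc b hb0
  obtain ⟨A₁, hA₁⟩ := exists_finset_abs_sum_sub_tsum_lt (f := cl) hsl ha0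
  obtain ⟨A₂, hA₂⟩ := exists_finset_abs_sum_sub_tsum_lt (f := cr) hsr ha0
  obtain ⟨A₃, hA₃⟩ := exists_finset_abs_sum_sub_tsum_lt (f := fun s => |leftJump u s| ^ 2)
    hu.summable_left ha0
  obtain ⟨A₄, hA₄⟩ := exists_finset_abs_sum_sub_tsum_lt (f := fun s => |rightJump u s| ^ 2)
    hu.summable_right ha0
  set F : Finset ℝ := hPfin.toFinset ∪ hF₀fin.toFinset ∪ (A₁ ∪ A₂ ∪ (A₃ ∪ A₄)) with hF
  have h₁ := hA₁ F (by intro x hx; simp [hF, hx])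
  have h₂ := hA₂ F (by intro x hx; simp [hF, hx])
  have h₃ := hA₃ F (by intro x hx; simp [hF, hx])
  have h₄ := hA₄ F (by intro x hx; simp [hF, hx])
  set η : ℝ := a / (2 * (F.card + 1)) with hη
  have hη0 : 0 < η := by positivity
  have hcard : 2 * F.card * η ≤ a := by
    have : 2 * (F.card + 1) * η = a := by rw [hη]; field_simp
    nlinarith
  obtain ⟨δ, hδ, hδτ⟩ := exists_gauge (T := T) (Q := GoodPair F u V L b η Ψ cl cr) fun y hy =>
    eventually_goodPair hu.regulated hη0 hcl hcr hy fun hyF => hF₀ y hy fun h => hyF (by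
      simp [hF, h])
  refine ⟨δ, hδ, fun τ hτ => ?_⟩
  have hgood := hδτ τ hτ
  have hmain := abs_sum_sub_sum_le hV hL hb0.le hη0.le hΨ hgood
  -- The points of `F` are tags, so the partition cut at its tags refines the one from `W₂^*`.
  have hquad := hP τ fun x hx => by
    have hxF : x ∈ F := by simp [hF, hx]
    have hxI := hPsub hx
    rcases hxI.1.eq_or_lt with h0 | h0
    · exact Or.inl ⟨0, Nat.zero_le _, by rw [τ.pt_zero, h0]⟩
    · obtain ⟨i, hi, hxi⟩ := τ.exists_mem_Ioc ⟨h0, hxI.2⟩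
      exact Or.inr ⟨i, hi, (forces_of_goodPair hgood i hi x hxF (Ioc_subset_Icc_self hxi)).symm⟩
  rw [sigmaTwo] at hquad
  set Q := ∑ i ∈ Finset.range τ.n, ((u (τ.tag i) - u (τ.pt i)) ^ 2 +
    (u (τ.pt (i + 1)) - u (τ.tag i)) ^ 2)
  have hLQ : L * (Q - (∑ f ∈ F with f ∈ Ioc 0 T, |leftJump u f| ^ 2) -
      (∑ f ∈ F with f ∈ Ico 0 T, |rightJump u f| ^ 2) + 2 * F.card * η) ≤ L * (4 * a) := by
    refine mul_le_mul_of_nonneg_left ?_ hL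
    linarith [(abs_lt.1 hquad).2, (abs_lt.1 h₃).1, (abs_lt.1 h₄).1]
  have hle := abs_le.1 (hmain.trans
    (add_le_add (add_le_add_left hLQ _) hcard))
  have h₁' := abs_lt.1 h₁
  have h₂' := abs_lt.1 h₂
  rw [abs_lt]
  constructor <;> nlinarith [hle.1, hle.2, h₁'.1, h₁'.2, h₂'.1, h₂'.2]

/-! ### Regulated functions -/

/-- A regulated function has only finitely many points of oscillation at least `ε`. -/
theorem IsRegulated.exists_finite {T : ℝ} {u : ℝ → ℝ} (hu : IsRegulated T u) {ε : ℝ}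
    (hε : 0 < ε) : ∃ F : Set ℝ, F.Finite ∧ ∀ y ∈ Icc 0 T, y ∉ F →
      ∀ᶠ s in 𝓝[Icc 0 T] y, |u s - u y| < ε := by
  have key : ∀ (x l : ℝ) (A : Set ℝ), IsOpen A → Tendsto u (𝓝[A] x) (𝓝 l) →
      ∀ᶠ y in 𝓝 x, y ∈ A → ∀ᶠ s in 𝓝[Icc 0 T] y, |u s - u y| < ε := by
    intro x l A hA hl
    have h1 : ∀ᶠ y in 𝓝[A] x, |u y - l| < ε / 2 := by
      filter_upwards [hl (Metric.ball_mem_nhds l (half_pos hε))] with y hy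
      rwa [mem_preimage, Metric.mem_ball, Real.dist_eq] at hy
    rw [← eventually_nhdsWithin_iff]
    filter_upwards [h1, eventually_eventually_nhdsWithin.2 h1, self_mem_nhdsWithin]
      with y hy hy' hyA
    rw [hA.nhdsWithin_eq hyA] at hy'
    filter_upwards [nhdsWithin_le_nhds hy'] with s hs
    have := abs_sub_lt_iff.1 hs
    have := abs_sub_lt_iff.1 hy
    exact abs_sub_lt_iff.2 ⟨by linarith, by linarith⟩
  refine isCompact_Icc.induction_on (p := fun A => ∃ F : Set ℝ, F.Finite ∧ ∀ y ∈ A, y ∉ F →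
      ∀ᶠ s in 𝓝[Icc 0 T] y, |u s - u y| < ε) ⟨∅, finite_empty, by simp⟩ ?_ ?_ fun x hx => ?_
  · rintro A B hAB ⟨F, hF, h⟩
    exact ⟨F, hF, fun y hy => h y (hAB hy)⟩
  · rintro A B ⟨F, hF, h⟩ ⟨F', hF', h'⟩
    refine ⟨F ∪ F', hF.union hF', fun y hy hyF => ?_⟩
    rw [mem_union, not_or] at hyF
    exact hy.elim (fun hy => h y hy hyF.1) fun hy => h' y hy hyF.2
  · have hl : ∀ᶠ y in 𝓝[Icc 0 T] x, y < x → ∀ᶠ s in 𝓝[Icc 0 T] y, |u s - u y| < ε := by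
      rcases hx.1.eq_or_lt with h0 | h0
      · filter_upwards [self_mem_nhdsWithin] with y hy hyx
        exact absurd (hy.1.trans_lt hyx) (by rw [h0]; exact lt_irrefl _)
      · obtain ⟨l, hl⟩ := hu.1 x ⟨h0, hx.2⟩
        exact nhdsWithin_le_nhds (key x l _ isOpen_Iio hl)
    have hr : ∀ᶠ y in 𝓝[Icc 0 T] x, x < y → ∀ᶠ s in 𝓝[Icc 0 T] y, |u s - u y| < ε := by
      rcases hx.2.eq_or_lt with h0 | h0
      · filter_upwards [self_mem_nhdsWithin] with y hy hyx
        exact absurd (hyx.trans_le hy.2) (by rw [h0]; exact lt_irrefl _)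
      · obtain ⟨l, hl⟩ := hu.2 x ⟨hx.1, h0⟩
        exact nhdsWithin_le_nhds (key x l _ isOpen_Ioi hl)
    exact ⟨_, hl.and hr, {x}, finite_singleton x, fun y hy hyx =>
      (lt_or_gt_of_ne hyx).elim hy.1 hy.2⟩

theorem aestronglyMeasurable_restrict_of_countable {S : Set ℝ} (hS : S.Countable) (f : ℝ → ℝ)
    (ν : Measure ℝ) : AEStronglyMeasurable f (ν.restrict S) := by
  have := hS.to_subtype
  rw [← biUnion_of_singleton S, biUnion_eq_iUnion, aestronglyMeasurable_iUnion_iff]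
  refine fun x => (aestronglyMeasurable_const (b := f x)).congr ?_
  filter_upwards [ae_restrict_mem (measurableSet_singleton _)] with y hy
  rw [mem_singleton_iff.1 hy]

/-- Regulated functions are measurable, as they have only countably many discontinuities. -/
theorem IsRegulated.aestronglyMeasurable {T : ℝ} {u : ℝ → ℝ} (hu : IsRegulated T u)
    (ν : Measure ℝ) : AEStronglyMeasurable u (ν.restrict (Icc 0 T)) := by
  choose F hF hFu using fun n : ℕ => hu.exists_finite (Nat.one_div_pos_of_nat (α := ℝ) (n := n))
  set C := ⋃ n, F n
  have hC : C.Countable := countable_iUnion fun n => (hF n).countable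
  have hcont : ContinuousOn u (Icc 0 T \ C) := by
    intro y hy
    refine ContinuousWithinAt.mono (t := Icc 0 T) (Metric.tendsto_nhds.2 fun ε hε => ?_)
      sdiff_subset
    obtain ⟨n, hn⟩ := exists_nat_one_div_lt hε
    filter_upwards [hFu n y hy.1 fun h => hy.2 (mem_iUnion.2 ⟨n, h⟩)] with s hs
    rw [Real.dist_eq]
    exact hs.trans hn
  have h1 := hcont.aestronglyMeasurable (μ := ν) (measurableSet_Icc.diff hC.measurableSet)
  have h2 := aestronglyMeasurable_restrict_of_countable hC u ν
  exact (aestronglyMeasurable_union_iff.2 ⟨h1, h2⟩).mono_measure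
    (Measure.restrict_mono (by rw [sdiff_union_self]; exact subset_union_left) le_rfl)

theorem mem_rangeInterval {T : ℝ} {u : ℝ → ℝ} (hu : Bornology.IsBounded (u '' Icc 0 T)) {s : ℝ}
    (hs : s ∈ Icc 0 T) : u s ∈ rangeInterval T u :=
  ⟨csInf_le hu.bddBelow ⟨s, hs, rfl⟩, le_csSup hu.bddAbove ⟨s, hs, rfl⟩⟩

theorem IsRegulated.isBounded_image {T : ℝ} {u : ℝ → ℝ} (hu : IsRegulated T u) :
    Bornology.IsBounded (u '' Icc 0 T) := by
  refine isCompact_Icc.induction_on (p := fun A => Bornology.IsBounded (u '' A)) (by simp)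
    (fun A B hAB h => h.subset (image_mono hAB)) (fun A B hA hB => by
      rw [image_union]; exact hA.union hB) fun x hx => ?_
  have hl : ∃ A, A ∈ 𝓝 x ∧ Bornology.IsBounded (u '' (A ∩ (Icc 0 T ∩ Iio x))) := by
    rcases hx.1.eq_or_lt with h0 | h0
    · refine ⟨univ, univ_mem, ?_⟩
      have : Icc 0 T ∩ Iio x = ∅ := by
        ext y
        simp only [mem_inter_iff, mem_Icc, mem_Iio, mem_empty_iff_false, iff_false]
        rintro ⟨⟨h, _⟩, h'⟩
        linarith
      simp [this]
    · obtain ⟨l, hl⟩ := hu.1 x ⟨h0, hx.2⟩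
      obtain ⟨A, hA, h⟩ := mem_nhdsWithin_iff_exists_mem_nhds_inter.1
        (hl (Metric.ball_mem_nhds l one_pos))
      refine ⟨A, hA, (Metric.isBounded_ball (x := l) (r := 1)).subset ?_⟩
      rintro _ ⟨y, hy, rfl⟩
      exact h ⟨hy.1, hy.2.2⟩
  have hr : ∃ A, A ∈ 𝓝 x ∧ Bornology.IsBounded (u '' (A ∩ (Icc 0 T ∩ Ioi x))) := by
    rcases hx.2.eq_or_lt with h0 | h0
    · refine ⟨univ, univ_mem, ?_⟩
      have : Icc 0 T ∩ Ioi x = ∅ := by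
        ext y
        simp only [mem_inter_iff, mem_Icc, mem_Ioi, mem_empty_iff_false, iff_false]
        rintro ⟨⟨_, h⟩, h'⟩
        linarith
      simp [this]
    · obtain ⟨l, hl⟩ := hu.2 x ⟨hx.1, h0⟩
      obtain ⟨A, hA, h⟩ := mem_nhdsWithin_iff_exists_mem_nhds_inter.1
        (hl (Metric.ball_mem_nhds l one_pos))
      refine ⟨A, hA, (Metric.isBounded_ball (x := l) (r := 1)).subset ?_⟩
      rintro _ ⟨y, hy, rfl⟩
      exact h ⟨hy.1, hy.2.2⟩
  obtain ⟨A, hA, hAb⟩ := hl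
  obtain ⟨B, hB, hBb⟩ := hr
  refine ⟨_, inter_mem_nhdsWithin _ (inter_mem hA hB), ((hAb.union hBb).union
    (Bornology.isBounded_singleton (x := u x))).subset ?_⟩
  rintro _ ⟨y, hy, rfl⟩
  rcases lt_trichotomy y x with h | h | h
  · exact Or.inl (Or.inl ⟨y, ⟨hy.2.1, hy.1, h⟩, rfl⟩)
  · exact Or.inr (by rw [h]; rfl)
  · exact Or.inl (Or.inr ⟨y, ⟨hy.2.2, hy.1, h⟩, rfl⟩)

theorem Icc_mem_nhdsLT {T y : ℝ} (hy : y ∈ Ioc 0 T) : Icc 0 T ∈ 𝓝[<] y :=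
  mem_of_superset (Ioo_mem_nhdsLT hy.1) fun _ hx => ⟨hx.1.le, hx.2.le.trans hy.2⟩

theorem Icc_mem_nhdsGT {T y : ℝ} (hy : y ∈ Ico 0 T) : Icc 0 T ∈ 𝓝[>] y :=
  mem_of_superset (Ioo_mem_nhdsGT hy.2) fun _ hx => ⟨hy.1.trans hx.1.le, hx.2.le⟩

theorem eventually_forall_mem_uIcc {T y : ℝ} (hy : y ∈ Icc 0 T) {p : ℝ → Prop}
    (h : ∀ᶠ s in 𝓝[Icc 0 T] y, p s) : ∀ᶠ s in 𝓝[Icc 0 T] y, ∀ x ∈ uIcc y s, p x := by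
  obtain ⟨d, hd, hball⟩ := Metric.mem_nhdsWithin_iff.1 h
  refine Metric.mem_nhdsWithin_iff.2 ⟨d, hd, fun s hs x hx => hball ⟨?_, ?_⟩⟩
  · have := hs.1
    rw [Metric.mem_ball, Real.dist_eq] at this ⊢
    exact (abs_sub_left_of_mem_uIcc hx).trans_lt this
  · exact ordConnected_Icc.uIcc_subset hy hs.2 hx

/-! ### The Lebesgue–Stieltjes integral as a Henstock–Kurzweil integral -/

instance isFiniteMeasure_variation (μ : SignedMeasure ℝ) : IsFiniteMeasure μ.variation := by
  rw [← μ.totalVariation_eq_variation]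
  infer_instance

/-- The Lebesgue–Stieltjes integral of `f` over `(-∞,t)`, together with the part of the integral
over `{t}` which stems from the left jump of `w`. This makes the increments of the primitive
comparable to the increments of `w` between the same two points. -/
def lsPrimitive {w : ℝ → ℝ} (hw : BoundedVariationOn w univ) (f : ℝ → ℝ) (t : ℝ) : ℝ :=
  ∫ᵛ x in Iio t, f x ∂•hw.vectorMeasure + f t * leftJump w t

/-- The increments of `lsPrimitive` over `[s,t]` are compared with those of `c * w`. The two jumps
at `s` and `t` which point into the interval are weighted separately, as one of these weights
vanishes when `c` is the value of `f` at that endpoint. -/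
theorem abs_lsPrimitive_sub_le {w : ℝ → ℝ} (hw : BoundedVariationOn w univ) {f : ℝ → ℝ}
    (hf : hw.vectorMeasure.Integrable f) {s t : ℝ} (hst : s < t) {c D : ℝ}
    (hD : ∀ x ∈ Ioo s t, |f x - c| ≤ D) :
    |lsPrimitive hw f t - lsPrimitive hw f s - c * (w t - w s)| ≤
      |f s - c| * |rightJump w s| + D * hw.vectorMeasure.variation.real (Ioo s t) +
        |f t - c| * |leftJump w t| := by
  set μ := hw.vectorMeasure with hμ
  have hsplit : ∫ᵛ x in Iio t, f x ∂•μ =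
      ∫ᵛ x in Iio s, f x ∂•μ + (f s * (w.rightLim s - w.leftLim s) + ∫ᵛ x in Ioo s t, f x ∂•μ) := by
    have hset : Iio t = Iio s ∪ ({s} ∪ Ioo s t) := by
      ext x
      simp only [mem_Iio, mem_union, mem_singleton_iff, mem_Ioo]
      constructor
      · intro h
        rcases lt_trichotomy x s with h' | h' | h'
        · exact Or.inl h'
        · exact Or.inr (Or.inl h')
        · exact Or.inr (Or.inr ⟨h', h⟩)
      · rintro (h | rfl | h)
        · exact h.trans hst
        · exact hst
        · exact h.2
    rw [hset, VectorMeasure.setIntegral_union _ measurableSet_Iio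
        ((measurableSet_singleton s).union measurableSet_Ioo) hf.integrableOn hf.integrableOn,
      VectorMeasure.setIntegral_union _ (measurableSet_singleton s) measurableSet_Ioo
        hf.integrableOn hf.integrableOn, VectorMeasure.integral_singleton,
      hw.vectorMeasure_singleton]
    · rfl
    · simp
    · rw [disjoint_left]
      rintro x hx (rfl | hx')
      · exact lt_irrefl x hx
      · exact lt_asymm hx hx'.1
  have hconst : ∫ᵛ x in Ioo s t, f x ∂•μ =
      ∫ᵛ x in Ioo s t, (f x - c) ∂•μ + c * (w.leftLim t - w.rightLim s) := by
    rw [VectorMeasure.integral_fun_sub hf.restrict (integrable_const c),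
      VectorMeasure.setIntegral_const, hμ, hw.vectorMeasure_Ioo hst]
    simp
  have hbound : |∫ᵛ x in Ioo s t, (f x - c) ∂•μ| ≤ D * μ.variation.real (Ioo s t) := by
    have := VectorMeasure.norm_setIntegral_le_of_norm_le_const (μ := μ) (s := Ioo s t)
      (B := ContinuousLinearMap.lsmul ℝ ℝ) (f := fun x => f x - c) (C := D) hD
    rwa [ContinuousLinearMap.opNorm_lsmul, mul_one] at this
  have heq : lsPrimitive hw f t - lsPrimitive hw f s - c * (w t - w s) =
      (f s - c) * rightJump w s + ∫ᵛ x in Ioo s t, (f x - c) ∂•μ + (f t - c) * leftJump w t := by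
    rw [lsPrimitive, lsPrimitive, ← hμ, hsplit, hconst, leftJump, leftJump, rightJump]
    ring
  rw [heq, ← abs_mul, ← abs_mul]
  exact (abs_add_three _ _ _).trans (by gcongr)

theorem memW2Star_zero {T : ℝ} (hT : 0 ≤ T) : MemW2Star T fun _ => 0 := by
  have hl : ∀ s, leftJump (fun _ => (0 : ℝ)) s = 0 := fun s => by
    rw [leftJump, leftLim_eq_of_tendsto tendsto_const_nhds, sub_zero]
  have hr : ∀ s, rightJump (fun _ => (0 : ℝ)) s = 0 := fun s => by
    rw [rightJump, rightLim_eq_of_tendsto tendsto_const_nhds, sub_zero]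
  obtain ⟨l, -⟩ := exists_intervalPartition_of_monotone 1 (fun i => i * T) (by simp)
    (fun j _ => by push_cast; linarith) T (by simp)
  exact ⟨⟨fun _ _ => ⟨0, tendsto_const_nhds⟩, fun _ _ => ⟨0, tendsto_const_nhds⟩⟩, by simp [hl],
    by simp [hr], fun ε hε => ⟨l, fun κ _ => by simpa [sigmaTwo, hl, hr] using hε⟩⟩

theorem tendsto_rightJump_nhdsLT {w : ℝ → ℝ} (hw : BoundedVariationOn w univ) (y : ℝ) :
    Tendsto (rightJump w) (𝓝[<] y) (𝓝 0) := by
  have h1 := hw.rightLim.tendsto_leftLim y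
  rw [leftLim_rightLim (hw.tendsto_leftLim y)] at h1
  simpa using! h1.sub (hw.tendsto_leftLim y)

theorem tendsto_leftJump_nhdsGT {w : ℝ → ℝ} (hw : BoundedVariationOn w univ) (y : ℝ) :
    Tendsto (leftJump w) (𝓝[>] y) (𝓝 0) := by
  have h1 := hw.leftLim.tendsto_rightLim y
  rw [rightLim_leftLim (hw.tendsto_rightLim y)] at h1
  simpa using! (hw.tendsto_rightLim y).sub h1

theorem tendsto_real_Ioo_nhdsLT (μ : Measure ℝ) [IsFiniteMeasure μ] (y : ℝ) :
    Tendsto (fun s => μ.real (Ioo s y)) (𝓝[<] y) (𝓝 0) := by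
  have h := tendsto_measure_of_tendsto_indicator_of_isFiniteMeasure (𝓝[<] y) (A := ∅)
    (As := fun s => Ioo s y) μ (fun _ => measurableSet_Ioo) fun x => by
      by_cases hx : x < y
      · filter_upwards [Ioo_mem_nhdsLT hx] with s hs
        simp [hs.1.le]
      · exact Eventually.of_forall fun s => by simp [hx]
  simpa [Measure.real] using! (ENNReal.tendsto_toReal (by simp)).comp h

theorem tendsto_real_Ioo_nhdsGT (μ : Measure ℝ) [IsFiniteMeasure μ] (y : ℝ) :
    Tendsto (fun s => μ.real (Ioo y s)) (𝓝[>] y) (𝓝 0) := by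
  have h := tendsto_measure_of_tendsto_indicator_of_isFiniteMeasure (𝓝[>] y) (A := ∅)
    (As := fun s => Ioo y s) μ (fun _ => measurableSet_Ioo) fun x => by
      by_cases hx : y < x
      · filter_upwards [Ioo_mem_nhdsGT hx] with s hs
        simp [hs.2.le]
      · exact Eventually.of_forall fun s => by simp [hx]
  simpa [Measure.real] using! (ENNReal.tendsto_toReal (by simp)).comp h

theorem abs_rightJump_le_variation {w : ℝ → ℝ} (hw : BoundedVariationOn w univ) {s t : ℝ}
    (hst : s < t) :
    |rightJump w s| ≤ variationOnFromTo w univ 0 t - variationOnFromTo w univ 0 s := by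
  have hmono : Monotone (variationOnFromTo w univ 0) := monotoneOn_univ.1
    (variationOnFromTo.monotoneOn hw.locallyBoundedVariationOn (mem_univ 0))
  have h := hmono.rightLim_le hst
  rw [variationOnFromTo.rightLim_eq hw, dist_comm, Real.dist_eq] at h
  exact le_sub_iff_add_le'.2 h

theorem abs_leftJump_le_variation {w : ℝ → ℝ} (hw : BoundedVariationOn w univ) {s t : ℝ}
    (hst : s < t) :
    |leftJump w t| ≤ variationOnFromTo w univ 0 t - variationOnFromTo w univ 0 s := by
  have hmono : Monotone (variationOnFromTo w univ 0) := monotoneOn_univ.1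
    (variationOnFromTo.monotoneOn hw.locallyBoundedVariationOn (mem_univ 0))
  have h := hmono.le_leftLim hst
  rw [variationOnFromTo.leftLim_eq hw, Real.dist_eq] at h
  exact le_sub_comm.1 h

/-- A bounded function with finitely many oscillations of size `ε`, for each `ε`, is
Henstock–Kurzweil integrable with respect to `w`, and `lsPrimitive` is its indefinite integral. -/
theorem hasHKIntegral_lsPrimitive {T : ℝ} (hT : 0 ≤ T) {w : ℝ → ℝ}
    (hw : BoundedVariationOn w univ) {f : ℝ → ℝ} (hf : hw.vectorMeasure.Integrable f) {M : ℝ}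
    (hM : ∀ x, |f x| ≤ M) (hreg : ∀ ε > 0, ∃ F : Set ℝ, F.Finite ∧ ∀ y ∈ Icc 0 T, y ∉ F →
      ∀ᶠ s in 𝓝[Icc 0 T] y, |f s - f y| < ε) :
    HasHKIntegral T f w (lsPrimitive hw f T - lsPrimitive hw f 0) := by
  set ν := hw.vectorMeasure.variation with hν
  set Ψ : ℝ → ℝ → ℝ := fun y s =>
    f y * (w s - w y) - (lsPrimitive hw f s - lsPrimitive hw f y) with hΨ
  set V : ℝ → ℝ := fun s => variationOnFromTo w univ 0 s + ν.real (Iio s) with hV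
  have hvar : Monotone (variationOnFromTo w univ 0) := monotoneOn_univ.1
    (variationOnFromTo.monotoneOn hw.locallyBoundedVariationOn (mem_univ 0))
  have hVmono : Monotone V := hvar.add fun s t hst => measureReal_mono (Iio_subset_Iio hst)
  have hIoo : ∀ {s t : ℝ}, s < t → ν.real (Ioo s t) ≤ ν.real (Iio t) - ν.real (Iio s) := by
    intro s t hst
    rw [le_sub_iff_add_le, ← measureReal_union ?_ measurableSet_Iio]
    · exact measureReal_mono fun x hx => hx.elim (fun h => h.2) fun h => lt_trans h hst
    · rw [disjoint_left]
      exact fun x hx hx' => lt_asymm hx.1 hx'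
  -- The two cases of the estimate: the tag is the right or the left end of the interval.
  have hleft : ∀ {s y D : ℝ}, s < y → |f s - f y| ≤ D → (∀ x ∈ Ioo s y, |f x - f y| ≤ D) →
      |Ψ y s| ≤ D * |rightJump w s| + D * ν.real (Ioo s y) := by
    intro s y D hsy hs hD
    have h := abs_lsPrimitive_sub_le hw hf hsy hD
    rw [sub_self, abs_zero, zero_mul, add_zero] at h
    calc |Ψ y s| = |lsPrimitive hw f y - lsPrimitive hw f s - f y * (w y - w s)| := by
          simp only [hΨ]; ring_nf
      _ ≤ _ := h
      _ ≤ _ := by gcongr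
  have hright : ∀ {y t D : ℝ}, y < t → |f t - f y| ≤ D → (∀ x ∈ Ioo y t, |f x - f y| ≤ D) →
      |Ψ y t| ≤ D * ν.real (Ioo y t) + D * |leftJump w t| := by
    intro y t D hyt ht hD
    have h := abs_lsPrimitive_sub_le hw hf hyt hD
    rw [sub_self, abs_zero, zero_mul, zero_add] at h
    calc |Ψ y t| = |lsPrimitive hw f t - lsPrimitive hw f y - f y * (w t - w y)| := by
          rw [← abs_neg]; simp only [hΨ]; ring_nf
      _ ≤ _ := h
      _ ≤ _ := by gcongr
  have hosc : ∀ x y, |f x - f y| ≤ 2 * M := fun x y =>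
    (abs_sub _ _).trans (by linarith [hM x, hM y])
  intro ε hε
  obtain ⟨δ, hδ, hδτ⟩ := exists_gauge_abs_sum_sub_lt (Ψ := Ψ) (cl := fun _ => 0)
    (cr := fun _ => 0) hT (memW2Star_zero hT) (hVmono.monotoneOn _) le_rfl (fun y => by simp [hΨ])
    (fun y _ => by
      refine squeeze_zero_norm' (a := fun s => 2 * M * |rightJump w s| + 2 * M * ν.real (Ioo s y))
        ?_ ?_ |>.trans (by simp)
      · filter_upwards [self_mem_nhdsWithin] with s hs
        exact hleft hs (hosc _ _) fun x _ => hosc _ _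
      · simpa using ((tendsto_rightJump_nhdsLT hw y).abs.const_mul (2 * M)).add
          ((tendsto_real_Ioo_nhdsLT ν y).const_mul (2 * M)))
    (fun y _ => by
      refine squeeze_zero_norm' (a := fun s => 2 * M * ν.real (Ioo y s) + 2 * M * |leftJump w s|)
        ?_ ?_
      · filter_upwards [self_mem_nhdsWithin] with s hs
        exact hright hs (hosc _ _) fun x _ => hosc _ _
      · simpa using ((tendsto_real_Ioo_nhdsGT ν y).const_mul (2 * M)).add
          ((tendsto_leftJump_nhdsGT hw y).abs.const_mul (2 * M)))
    summable_zero summable_zero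
    (fun ε hε => by
      obtain ⟨F, hF, h⟩ := hreg ε hε
      refine ⟨F, hF, fun y hy hyF => ?_⟩
      filter_upwards [eventually_forall_mem_uIcc hy (h y hy hyF)] with s hs
      rw [sub_self, zero_pow two_ne_zero, mul_zero, zero_add]
      rcases lt_trichotomy s y with hsy | rfl | hsy
      · rw [uIcc_of_ge hsy.le] at hs
        refine (hleft hsy (hs s ⟨le_rfl, hsy.le⟩).le
          fun x hx => (hs x (Ioo_subset_Icc_self hx)).le).trans ?_
        rw [abs_sub_comm, abs_of_nonneg (sub_nonneg.2 (hVmono hsy.le)), ← mul_add]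
        refine mul_le_mul_of_nonneg_left ?_ hε.le
        linarith [abs_rightJump_le_variation hw hsy, hIoo hsy]
      · simp [hΨ]
      · rw [uIcc_of_le hsy.le] at hs
        refine (hright hsy (hs s ⟨hsy.le, le_rfl⟩).le
          fun x hx => (hs x (Ioo_subset_Icc_self hx)).le).trans ?_
        rw [abs_of_nonneg (sub_nonneg.2 (hVmono hsy.le)), ← mul_add]
        refine mul_le_mul_of_nonneg_left ?_ hε.le
        linarith [abs_leftJump_le_variation hw hsy, hIoo hsy]) hε
  refine ⟨δ, hδ, fun τ hτ => ?_⟩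
  have h := hδτ τ hτ
  have htel := Finset.sum_range_sub (fun i => lsPrimitive hw f (τ.pt i)) τ.n
  rw [τ.pt_zero, τ.pt_last] at htel
  have hsum : ∑ i ∈ Finset.range τ.n, (Ψ (τ.tag i) (τ.pt (i + 1)) - Ψ (τ.tag i) (τ.pt i)) =
      riemannSum f w τ - (lsPrimitive hw f T - lsPrimitive hw f 0) := by
    rw [← htel, riemannSum, ← Finset.sum_sub_distrib]
    exact Finset.sum_congr rfl fun i _ => by simp only [hΨ]; ring
  rw [hsum, tsum_zero, tsum_zero, add_zero, sub_zero] at h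
  exact h

theorem constExtend_eqOn {T : ℝ} (hT : 0 ≤ T) (u : ℝ → ℝ) :
    EqOn (constExtend T hT u) u (Icc 0 T) := fun s hs => by
  rw [constExtend, projIcc_of_mem hT hs]

/-- A regulated function is integrable with respect to a function of bounded variation in the
senses of Lebesgue–Stieltjes and of Henstock–Kurzweil, and both integrals agree. -/
theorem IsRegulated.exists_integral {T : ℝ} (hT : 0 ≤ T) {u : ℝ → ℝ}
    (hu : BoundedVariationOn u (Icc 0 T)) {f : ℝ → ℝ} (hf : IsRegulated T f) :
    ∃ I, HasLSIntegral hT hu f I ∧ HasHKIntegral T f u I := by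
  set w := constExtend T hT u with hw_def
  have hw := boundedVariationOn_constExtend hT hu
  have hwu : EqOn w u (Icc 0 T) := constExtend_eqOn hT u
  set μ := hw.vectorMeasure with hμ
  obtain ⟨M, hM⟩ := hf.isBounded_image.exists_norm_le
  -- Cutting `f` off outside `[0,T]` turns it into a globally bounded integrable function.
  set g := (Icc 0 T).indicator f with hg
  have hgf : EqOn g f (Icc 0 T) := fun x hx => indicator_of_mem hx f
  have hgM : ∀ x, |g x| ≤ max M 0 := by
    intro x
    by_cases hx : x ∈ Icc 0 T
    · rw [hgf hx]
      exact (hM _ ⟨x, hx, rfl⟩).trans (le_max_left _ _)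
    · rw [hg, indicator_of_notMem hx, abs_zero]
      exact le_max_right _ _
  have hgint : μ.Integrable g := by
    refine Integrable.of_bound ?_ (max M 0) (Eventually.of_forall hgM)
    exact (aestronglyMeasurable_indicator_iff measurableSet_Icc).2 (hf.aestronglyMeasurable _)
  have hfint : μ.IntegrableOn f (Icc 0 T) :=
    (VectorMeasure.integrable_indicator_iff measurableSet_Icc).1 hgint
  refine ⟨_, ⟨hfint, rfl⟩, ?_⟩
  have hHK := hasHKIntegral_lsPrimitive hT hw hgint hgM fun ε hε => by
    obtain ⟨F, hF, h⟩ := hf.exists_finite hε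
    refine ⟨F, hF, fun y hy hyF => ?_⟩
    filter_upwards [h y hy hyF, self_mem_nhdsWithin] with s hs hsI
    rwa [hgf hsI, hgf hy]
  have hzero : lsPrimitive hw g 0 = 0 := by
    have h1 : ∫ᵛ x in Iio 0, g x ∂•μ = 0 :=
      VectorMeasure.setIntegral_eq_zero_of_forall_eq_zero fun x hx =>
        indicator_of_notMem (fun h => (not_lt.2 h.1) hx) f
    have h2 : w.leftLim 0 = w 0 := by
      refine leftLim_eq_of_tendsto (tendsto_const_nhds.congr' ?_)
      filter_upwards [self_mem_nhdsWithin] with x hx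
      rw [hw_def, constExtend, constExtend, projIcc_of_le_left hT (le_of_lt hx),
        projIcc_of_le_left hT le_rfl]
    rw [lsPrimitive, ← hμ, h1, leftJump, h2, sub_self, mul_zero, add_zero]
  have hlast : lsPrimitive hw g T = ∫ᵛ x in Icc 0 T, f x ∂•μ := by
    have h2 : w.rightLim T = w T := by
      refine rightLim_eq_of_tendsto (tendsto_const_nhds.congr' ?_)
      filter_upwards [self_mem_nhdsWithin] with x hx
      rw [hw_def, constExtend, constExtend, projIcc_of_right_le hT (le_of_lt hx),
        projIcc_of_right_le hT le_rfl]
    have h3 : ∫ᵛ x in {T}, g x ∂•μ = g T * leftJump w T := by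
      rw [VectorMeasure.integral_singleton, hμ, hw.vectorMeasure_singleton, h2]
      rfl
    rw [← VectorMeasure.integral_indicator measurableSet_Icc, lsPrimitive, ← hμ, ← h3,
      ← VectorMeasure.setIntegral_union (by simp) measurableSet_Iio (measurableSet_singleton T)
        hgint.integrableOn hgint.integrableOn]
    refine VectorMeasure.setIntegral_eq_integral_of_forall_compl_eq_zero
      (measurableSet_Iio.union (measurableSet_singleton T)) fun x hx =>
        indicator_of_notMem (fun h => hx ?_) f
    exact h.2.lt_or_eq
  rw [hzero, hlast, sub_zero] at hHK
  intro ε hε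
  obtain ⟨δ, hδ, h⟩ := hHK ε hε
  refine ⟨δ, hδ, fun τ hτ => ?_⟩
  have hsum : riemannSum g w τ = riemannSum f u τ := Finset.sum_congr rfl fun i hi => by
    have hi := Finset.mem_range.1 hi
    rw [hgf (τ.tag_mem_Icc hi), hwu (τ.pt_mem_Icc (Nat.succ_le_of_lt hi)),
      hwu (τ.pt_mem_Icc hi.le)]
  rw [← hsum]
  exact h τ hτ

/-! ### First-order Taylor estimates -/

/-- The remainder of the first-order Taylor expansion of `G` at `p`, evaluated at `q`. -/
def taylorRemainder (G G₁ G₂ : ℝ × ℝ → ℝ) (p q : ℝ × ℝ) : ℝ :=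
  G q - G p - G₁ p * (q.1 - p.1) - G₂ p * (q.2 - p.2)

theorem abs_sub_sub_mul_le_of_hasDerivWithinAt {f f' : ℝ → ℝ} {S : Set ℝ}
    (hf : ∀ x ∈ S, HasDerivWithinAt f (f' x) S x) {x y c D : ℝ} (hxy : uIcc x y ⊆ S)
    (hD : ∀ z ∈ uIcc x y, |f' z - c| ≤ D) : |f y - f x - c * (y - x)| ≤ D * |y - x| := by
  have hderiv : ∀ z ∈ uIcc x y, HasDerivWithinAt (fun z => f z - c * z) (f' z - c) (uIcc x y) z :=
    fun z hz => (((hf z (hxy hz)).mono hxy).fun_sub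
      ((hasDerivWithinAt_id z (uIcc x y)).const_mul c)).congr_deriv (by rw [mul_one])
  have h := (convex_uIcc x y).norm_image_sub_le_of_norm_hasDerivWithin_le (C := D) hderiv
    hD left_mem_uIcc right_mem_uIcc
  rw [Real.norm_eq_abs, Real.norm_eq_abs] at h
  convert h using 2
  ring

section

variable {G G₁ G₂ : ℝ × ℝ → ℝ} {A B : Set ℝ} [A.OrdConnected] [B.OrdConnected]

/-- If `∂G/∂x₁` is Lipschitz in `x₁`, the Taylor remainder is quadratic in the increment of `x₁`
and linear, with a factor given by the oscillation of `∂G/∂x₂`, in the increment of `x₂`. -/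
theorem IsC1On.abs_taylorRemainder_le (hG : IsC1On G G₁ G₂ A B) {K : ℝ} (hK : 0 ≤ K)
    (hLip : ∀ x ∈ A, ∀ x' ∈ A, ∀ y ∈ B, |G₁ (x, y) - G₁ (x', y)| ≤ K * |x - x'|)
    {p q : ℝ × ℝ} (hp : p ∈ A ×ˢ B) (hq : q ∈ A ×ˢ B) {D : ℝ}
    (hD : ∀ z ∈ uIcc p.2 q.2, |G₂ (q.1, z) - G₂ p| ≤ D) :
    |taylorRemainder G G₁ G₂ p q| ≤ K * (q.1 - p.1) ^ 2 + D * |q.2 - p.2| := by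
  have hA : uIcc p.1 q.1 ⊆ A := OrdConnected.uIcc_subset ‹_› hp.1 hq.1
  have hB : uIcc p.2 q.2 ⊆ B := OrdConnected.uIcc_subset ‹_› hp.2 hq.2
  -- The first coordinate is moved first, at height `p.2`, so that only `G₂` has to be compared
  -- at points with different second coordinates.
  have h1 := abs_sub_sub_mul_le_of_hasDerivWithinAt (fun x hx => hG.hasDeriv₁ x hx p.2 hp.2)
    (c := G₁ (p.1, p.2)) (D := K * |q.1 - p.1|) hA fun z hz =>
      (hLip z (hA hz) p.1 hp.1 p.2 hp.2).trans
        (mul_le_mul_of_nonneg_left (abs_sub_left_of_mem_uIcc hz) hK)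
  have h2 := abs_sub_sub_mul_le_of_hasDerivWithinAt (fun y hy => hG.hasDeriv₂ q.1 hq.1 y hy)
    (c := G₂ p) (D := D) hB hD
  rw [mul_assoc, abs_mul_abs_self, ← sq] at h1
  have heq : taylorRemainder G G₁ G₂ p q =
      (G (q.1, p.2) - G (p.1, p.2) - G₁ (p.1, p.2) * (q.1 - p.1)) +
        (G (q.1, q.2) - G (q.1, p.2) - G₂ p * (q.2 - p.2)) := by
    simp only [taylorRemainder, Prod.mk.eta]
    ring
  rw [heq]
  exact (abs_add_le _ _).trans (add_le_add h1 h2)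

theorem IsC1On.abs_taylorRemainder_le_of_bound (hG : IsC1On G G₁ G₂ A B) {K : ℝ} (hK : 0 ≤ K)
    (hLip : ∀ x ∈ A, ∀ x' ∈ A, ∀ y ∈ B, |G₁ (x, y) - G₁ (x', y)| ≤ K * |x - x'|)
    {C : ℝ} (hC : ∀ p ∈ A ×ˢ B, |G₂ p| ≤ C) {p q : ℝ × ℝ} (hp : p ∈ A ×ˢ B) (hq : q ∈ A ×ˢ B) :
    |taylorRemainder G G₁ G₂ p q| ≤ K * (q.1 - p.1) ^ 2 + 2 * C * |q.2 - p.2| := by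
  refine hG.abs_taylorRemainder_le hK hLip hp hq fun z hz => (abs_sub _ _).trans ?_
  have := hC (q.1, z) ⟨hq.1, OrdConnected.uIcc_subset ‹_› hp.2 hq.2 hz⟩
  linarith [hC p hp]

theorem IsC1On.continuousOn (hG : IsC1On G G₁ G₂ A B) {K : ℝ} (hK : 0 ≤ K)
    (hLip : ∀ x ∈ A, ∀ x' ∈ A, ∀ y ∈ B, |G₁ (x, y) - G₁ (x', y)| ≤ K * |x - x'|)
    {C : ℝ} (hC : ∀ p ∈ A ×ˢ B, |G₂ p| ≤ C) : ContinuousOn G (A ×ˢ B) := by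
  intro p hp
  have hrem : Tendsto (taylorRemainder G G₁ G₂ p) (𝓝[A ×ˢ B] p) (𝓝 0) := by
    refine squeeze_zero_norm' (a := fun q => K * (q.1 - p.1) ^ 2 + 2 * C * |q.2 - p.2|) ?_ ?_
    · filter_upwards [self_mem_nhdsWithin] with q hq
      exact hG.abs_taylorRemainder_le_of_bound hK hLip hC hp hq
    · have : Continuous fun q : ℝ × ℝ => K * (q.1 - p.1) ^ 2 + 2 * C * |q.2 - p.2| := by fun_prop
      simpa using (this.tendsto p).mono_left nhdsWithin_le_nhds
  have hlin : Tendsto (fun q : ℝ × ℝ => G p + G₁ p * (q.1 - p.1) + G₂ p * (q.2 - p.2))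
      (𝓝[A ×ˢ B] p) (𝓝 (G p)) := by
    have : Continuous fun q : ℝ × ℝ => G p + G₁ p * (q.1 - p.1) + G₂ p * (q.2 - p.2) := by
      fun_prop
    simpa using (this.tendsto p).mono_left nhdsWithin_le_nhds
  have := hrem.add hlin
  rw [zero_add] at this
  exact this.congr fun q => by rw [taylorRemainder]; ring

end

/-! ### Jumps of functions of bounded variation -/

/-- The limit has to exist because `Function.leftLim` otherwise takes the value at the point. -/
theorem leftLim_congr {u w : ℝ → ℝ} {s : ℝ} (h : u =ᶠ[𝓝[<] s] w)
    (hw : ∃ l, Tendsto w (𝓝[<] s) (𝓝 l)) : Function.leftLim u s = Function.leftLim w s :=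
  leftLim_eq_of_tendsto ((tendsto_leftLim_of_tendsto hw).congr' h.symm)

/-- The limit has to exist because `Function.rightLim` otherwise takes the value at the point. -/
theorem rightLim_congr {u w : ℝ → ℝ} {s : ℝ} (h : u =ᶠ[𝓝[>] s] w)
    (hw : ∃ l, Tendsto w (𝓝[>] s) (𝓝 l)) : Function.rightLim u s = Function.rightLim w s :=
  rightLim_eq_of_tendsto ((tendsto_rightLim_of_tendsto hw).congr' h.symm)

theorem sum_rightLim_sub_leftLim_le {V : ℝ → ℝ} (hV : Monotone V) {C : ℝ} (hC : ∀ x, -C ≤ V x)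
    (F : Finset ℝ) : ∀ b, (∀ x ∈ F, x < b) →
      ∑ x ∈ F, (Function.rightLim V x - Function.leftLim V x) ≤ Function.leftLim V b + C := by
  induction F using Finset.induction_on_max with
  | empty =>
    intro b _
    rw [Finset.sum_empty]
    linarith [hC (b - 1), hV.le_leftLim (sub_one_lt b)]
  | insert a F hF ih =>
    intro b hb
    rw [Finset.sum_insert fun h => lt_irrefl a (hF a h)]
    linarith [ih a hF, hV.rightLim_le_leftLim (hb a (Finset.mem_insert_self a F))]

theorem summable_rightLim_sub_leftLim {V : ℝ → ℝ} (hV : Monotone V) {C : ℝ}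
    (hC : ∀ x, |V x| ≤ C) : Summable fun x => Function.rightLim V x - Function.leftLim V x := by
  refine summable_of_sum_le (c := 2 * C) (fun x => sub_nonneg.2 (hV.leftLim_le_rightLim le_rfl))
    fun F => ?_
  obtain ⟨b, hb⟩ := F.bddAbove
  have h := sum_rightLim_sub_leftLim_le hV (fun x => (abs_le.1 (hC x)).1) F (b + 1)
    fun x hx => lt_of_le_of_lt (hb hx) (lt_add_one b)
  linarith [hV.leftLim_le (le_refl (b + 1)), (abs_le.1 (hC (b + 1))).2]

theorem summable_abs_leftJump {w : ℝ → ℝ} (hw : BoundedVariationOn w univ) :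
    Summable fun s => |leftJump w s| := by
  have hmono : Monotone (variationOnFromTo w univ 0) := monotoneOn_univ.1
    (variationOnFromTo.monotoneOn hw.locallyBoundedVariationOn (mem_univ 0))
  refine (summable_rightLim_sub_leftLim hmono
    fun x => variationOnFromTo.abs_le_eVariationOn hw).of_nonneg_of_le (fun _ => abs_nonneg _)
    fun s => ?_
  rw [variationOnFromTo.leftLim_eq hw, Real.dist_eq, leftJump]
  linarith [hmono.le_rightLim (le_refl s)]

theorem summable_abs_rightJump {w : ℝ → ℝ} (hw : BoundedVariationOn w univ) :
    Summable fun s => |rightJump w s| := by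
  have hmono : Monotone (variationOnFromTo w univ 0) := monotoneOn_univ.1
    (variationOnFromTo.monotoneOn hw.locallyBoundedVariationOn (mem_univ 0))
  refine (summable_rightLim_sub_leftLim hmono
    fun x => variationOnFromTo.abs_le_eVariationOn hw).of_nonneg_of_le (fun _ => abs_nonneg _)
    fun s => ?_
  rw [variationOnFromTo.rightLim_eq hw, dist_comm, Real.dist_eq, rightJump]
  linarith [hmono.leftLim_le (le_refl s)]

theorem isRegulated_of_boundedVariationOn {T : ℝ} (hT : 0 ≤ T) {u : ℝ → ℝ}
    (hu : BoundedVariationOn u (Icc 0 T)) :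
    IsRegulated T u := by
  have hw := boundedVariationOn_constExtend hT hu
  refine ⟨fun s hs => ⟨_, (hw.tendsto_leftLim s).congr' ?_⟩,
    fun s hs => ⟨_, (hw.tendsto_rightLim s).congr' ?_⟩⟩
  · exact (constExtend_eqOn hT u).eventuallyEq_of_mem (Icc_mem_nhdsLT hs)
  · exact (constExtend_eqOn hT u).eventuallyEq_of_mem (Icc_mem_nhdsGT hs)

theorem summable_abs_leftJump_of_boundedVariationOn {T : ℝ} (hT : 0 ≤ T) {u : ℝ → ℝ}
    (hu : BoundedVariationOn u (Icc 0 T)) :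
    Summable fun s : Ioc 0 T => |leftJump u s| := by
  have hw := boundedVariationOn_constExtend hT hu
  refine ((summable_abs_leftJump hw).subtype (Ioc 0 T)).congr fun s => ?_
  have heq := constExtend_eqOn hT u
  have hlim := leftLim_congr (heq.eventuallyEq_of_mem (Icc_mem_nhdsLT s.2))
    ((isRegulated_of_boundedVariationOn hT hu).1 s.1 s.2)
  simp only [Function.comp_apply, leftJump]
  rw [hlim, heq (Ioc_subset_Icc_self s.2)]

theorem summable_abs_rightJump_of_boundedVariationOn {T : ℝ} (hT : 0 ≤ T) {u : ℝ → ℝ}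
    (hu : BoundedVariationOn u (Icc 0 T)) :
    Summable fun s : Ico 0 T => |rightJump u s| := by
  have hw := boundedVariationOn_constExtend hT hu
  refine ((summable_abs_rightJump hw).subtype (Ico 0 T)).congr fun s => ?_
  have heq := constExtend_eqOn hT u
  have hlim := rightLim_congr (heq.eventuallyEq_of_mem (Icc_mem_nhdsGT s.2))
    ((isRegulated_of_boundedVariationOn hT hu).2 s.1 s.2)
  simp only [Function.comp_apply, rightJump]
  rw [hlim, heq (Ico_subset_Icc_self s.2)]

/-- On `[0,T]` the increments of `u` are dominated by those of the monotone function
`variationOnFromTo (constExtend T hT u) univ 0`. -/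
theorem abs_sub_le_abs_variation_sub {T : ℝ} (hT : 0 ≤ T) {u : ℝ → ℝ}
    (hu : BoundedVariationOn u (Icc 0 T))
    {s t : ℝ} (hs : s ∈ Icc 0 T) (ht : t ∈ Icc 0 T) :
    |u s - u t| ≤ |variationOnFromTo (constExtend T hT u) univ 0 s -
      variationOnFromTo (constExtend T hT u) univ 0 t| := by
  have hw := (boundedVariationOn_constExtend hT hu).locallyBoundedVariationOn
  rw [← constExtend_eqOn hT u hs, ← constExtend_eqOn hT u ht]
  rcases le_total t s with h | h
  · exact (variationOnFromTo.abs_sub_le_sub_of_le hw (mem_univ _) (mem_univ _) (mem_univ _) h).trans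
      (le_abs_self _)
  · rw [abs_sub_comm, abs_sub_comm (variationOnFromTo _ _ _ s)]
    exact (variationOnFromTo.abs_sub_le_sub_of_le hw (mem_univ _) (mem_univ _) (mem_univ _) h).trans
      (le_abs_self _)

/-! ### The chain rule -/

theorem tendsto_comp_of_continuousOn {H : ℝ × ℝ → ℝ} {S₁ S₂ : Set ℝ} (h₁ : IsClosed S₁)
    (h₂ : IsClosed S₂) (hH : ContinuousOn H (S₁ ×ˢ S₂)) {l : Filter ℝ} [l.NeBot] {u₁ u₂ : ℝ → ℝ}
    {a b : ℝ} (hu₁ : Tendsto u₁ l (𝓝 a)) (hu₂ : Tendsto u₂ l (𝓝 b))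
    (hmem : ∀ᶠ s in l, (u₁ s, u₂ s) ∈ S₁ ×ˢ S₂) :
    (a, b) ∈ S₁ ×ˢ S₂ ∧ Tendsto (fun s => H (u₁ s, u₂ s)) l (𝓝 (H (a, b))) := by
  have hlim := hu₁.prodMk_nhds hu₂
  have hab := (h₁.prod h₂).mem_of_tendsto hlim hmem
  exact ⟨hab, (hH _ hab).tendsto.comp (tendsto_nhdsWithin_iff.2 ⟨hlim, hmem⟩)⟩

end HKChainRule

end

open HKChainRule

theorem mainTheorem4 (T : ℝ) (hT : 0 < T) (u₁ u₂ : ℝ → ℝ)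
    (hu₁ : HKChainRule.MemW2Star T u₁) (hu₂ : BoundedVariationOn u₂ (Icc 0 T))
    (S₁ S₂ : Set ℝ) (hS₁ : S₁ = HKChainRule.rangeInterval T u₁)
    (hS₂ : S₂ = HKChainRule.rangeInterval T u₂)
    (G G₁ G₂ : ℝ × ℝ → ℝ) (hG : HKChainRule.IsC1On G G₁ G₂ S₁ S₂)
    (K₁ : ℝ) (hK₁ : 0 ≤ K₁)
    (K : ℝ × ℝ × ℝ → ℝ) (hKcont : ContinuousOn K (S₁ ×ˢ S₂ ×ˢ S₂))
    (hKnonneg : ∀ x₁ ∈ S₁, ∀ x₂ ∈ S₂, ∀ y₂ ∈ S₂, 0 ≤ K (x₁, x₂, y₂))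
    (hKdiag : ∀ x₁ ∈ S₁, ∀ x₂ ∈ S₂, K (x₁, x₂, x₂) = 0)
    (hLip : ∀ x₁ ∈ S₁, ∀ y₁ ∈ S₁, ∀ x₂ ∈ S₂,
      |G₁ (x₁, x₂) - G₁ (y₁, x₂)| ≤ K₁ * |x₁ - y₁|)
    (hHol : ∀ x₁ ∈ S₁, ∀ x₂ ∈ S₂, ∀ y₂ ∈ S₂,
      |G₁ (x₁, x₂) - G₁ (x₁, y₂)| ≤ K (x₁, x₂, y₂) * |x₂ - y₂| ^ (1 / 2 : ℝ)) :
    ∃ I₁ I₂ : ℝ,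
      HKChainRule.HasHKIntegral T (fun s => G₁ (u₁ s, u₂ s)) u₁ I₁ ∧
      HKChainRule.HasLSIntegral hT.le hu₂ (fun s => G₂ (u₁ s, u₂ s)) I₂ ∧
      HKChainRule.HasHKIntegral T (fun s => G₂ (u₁ s, u₂ s)) u₂ I₂ ∧
      (Summable fun s : Ioc 0 T => |HKChainRule.leftCorrection G G₁ G₂ u₁ u₂ s|) ∧
      (Summable fun s : Ico 0 T => |HKChainRule.rightCorrection G G₁ G₂ u₁ u₂ s|) ∧
      G (u₁ T, u₂ T) - G (u₁ 0, u₂ 0) =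
        I₁ + I₂ + (∑' s : Ioc 0 T, HKChainRule.leftCorrection G G₁ G₂ u₁ u₂ s)
          + ∑' s : Ico 0 T, HKChainRule.rightCorrection G G₁ G₂ u₁ u₂ s := by
  have hreg₁ := hu₁.regulated
  have hreg₂ := isRegulated_of_boundedVariationOn hT.le hu₂
  have hmem : ∀ s ∈ Icc 0 T, (u₁ s, u₂ s) ∈ S₁ ×ˢ S₂ := fun s hs => by
    rw [hS₁, hS₂]
    exact ⟨mem_rangeInterval hreg₁.isBounded_image hs, mem_rangeInterval hreg₂.isBounded_image hs⟩
  have hc₁ : IsCompact S₁ := by rw [hS₁]; exact isCompact_Icc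
  have hc₂ : IsCompact S₂ := by rw [hS₂]; exact isCompact_Icc
  have : S₁.OrdConnected := by rw [hS₁]; exact ordConnected_Icc
  have : S₂.OrdConnected := by rw [hS₂]; exact ordConnected_Icc
  obtain ⟨C, hC⟩ := (hc₁.prod hc₂).exists_bound_of_continuousOn hG.continuousOn₂
  have hGcont := hG.continuousOn hK₁ hLip hC
  have hlimL : ∀ (H : ℝ × ℝ → ℝ), ContinuousOn H (S₁ ×ˢ S₂) → ∀ s ∈ Ioc 0 T,
      (Function.leftLim u₁ s, Function.leftLim u₂ s) ∈ S₁ ×ˢ S₂ ∧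
      Tendsto (fun t => H (u₁ t, u₂ t)) (𝓝[<] s)
        (𝓝 (H (Function.leftLim u₁ s, Function.leftLim u₂ s))) := fun H hH s hs =>
    tendsto_comp_of_continuousOn hc₁.isClosed hc₂.isClosed hH
      (tendsto_leftLim_of_tendsto (hreg₁.1 s hs)) (tendsto_leftLim_of_tendsto (hreg₂.1 s hs))
      (mem_of_superset (Icc_mem_nhdsLT hs) hmem)
  have hlimR : ∀ (H : ℝ × ℝ → ℝ), ContinuousOn H (S₁ ×ˢ S₂) → ∀ s ∈ Ico 0 T,
      (Function.rightLim u₁ s, Function.rightLim u₂ s) ∈ S₁ ×ˢ S₂ ∧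
      Tendsto (fun t => H (u₁ t, u₂ t)) (𝓝[>] s)
        (𝓝 (H (Function.rightLim u₁ s, Function.rightLim u₂ s))) := fun H hH s hs =>
    tendsto_comp_of_continuousOn hc₁.isClosed hc₂.isClosed hH
      (tendsto_rightLim_of_tendsto (hreg₁.2 s hs)) (tendsto_rightLim_of_tendsto (hreg₂.2 s hs))
      (mem_of_superset (Icc_mem_nhdsGT hs) hmem)
  obtain ⟨I₂, hLS, hHK₂⟩ := IsRegulated.exists_integral hT.le hu₂
    (f := fun s => G₂ (u₁ s, u₂ s))
    ⟨fun s hs => ⟨_, (hlimL G₂ hG.continuousOn₂ s hs).2⟩,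
      fun s hs => ⟨_, (hlimR G₂ hG.continuousOn₂ s hs).2⟩⟩
  -- The correction terms are values of the Taylor remainder at the one-sided limits of `u`.
  have hleft : ∀ s, leftCorrection G G₁ G₂ u₁ u₂ s = -taylorRemainder G G₁ G₂ (u₁ s, u₂ s)
      (Function.leftLim u₁ s, Function.leftLim u₂ s) := fun s => by
    simp only [leftCorrection, taylorRemainder, leftJump]
    ring
  have hright : ∀ s, rightCorrection G G₁ G₂ u₁ u₂ s = taylorRemainder G G₁ G₂ (u₁ s, u₂ s)
      (Function.rightLim u₁ s, Function.rightLim u₂ s) := fun s => rfl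
  have hsumL : Summable fun s : Ioc 0 T => |leftCorrection G G₁ G₂ u₁ u₂ s| := by
    refine ((hu₁.summable_left.mul_left K₁).add
      ((summable_abs_leftJump_of_boundedVariationOn hT.le hu₂).mul_left (2 * C))).of_nonneg_of_le
      (fun _ => abs_nonneg _) fun s => ?_
    have h := hG.abs_taylorRemainder_le_of_bound hK₁ hLip hC (hmem s (Ioc_subset_Icc_self s.2))
      (hlimL G hGcont s s.2).1
    rwa [hleft, abs_neg, sq_abs, leftJump, leftJump, ← neg_sub, neg_sq, abs_sub_comm (u₂ s)]
  have hsumR : Summable fun s : Ico 0 T => |rightCorrection G G₁ G₂ u₁ u₂ s| := by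
    refine ((hu₁.summable_right.mul_left K₁).add
      ((summable_abs_rightJump_of_boundedVariationOn hT.le hu₂).mul_left (2 * C))).of_nonneg_of_le
      (fun _ => abs_nonneg _) fun s => ?_
    have h := hG.abs_taylorRemainder_le_of_bound hK₁ hLip hC (hmem s (Ico_subset_Icc_self s.2))
      (hlimR G hGcont s s.2).1
    rwa [hright, sq_abs]
  set cL := ∑' s : Ioc 0 T, leftCorrection G G₁ G₂ u₁ u₂ s with hcL
  set cR := ∑' s : Ico 0 T, rightCorrection G G₁ G₂ u₁ u₂ s with hcR
  -- The first integral is given by the formula to be proved; what has to be shown is that its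
  -- Riemann sums converge to this value.
  refine ⟨G (u₁ T, u₂ T) - G (u₁ 0, u₂ 0) - I₂ - (cL + cR), I₂, fun ε hε => ?_, hLS, hHK₂,
    hsumL, hsumR, by ring⟩
  set V := variationOnFromTo (constExtend T hT.le u₂) univ 0 with hV
  set Ψ : ℝ → ℝ → ℝ := fun y s => taylorRemainder G G₁ G₂ (u₁ y, u₂ y) (u₁ s, u₂ s) with hΨ
  have hremL : ∀ y ∈ Ioc 0 T,
      Tendsto (Ψ y) (𝓝[<] y) (𝓝 (-leftCorrection G G₁ G₂ u₁ u₂ y)) := fun y hy => by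
    rw [hleft, neg_neg]
    refine (((hlimL G hGcont y hy).2.sub_const _).sub (Tendsto.const_mul _ ?_)).sub
      (Tendsto.const_mul _ ?_)
    · exact (tendsto_leftLim_of_tendsto (hreg₁.1 y hy)).sub_const _
    · exact (tendsto_leftLim_of_tendsto (hreg₂.1 y hy)).sub_const _
  have hremR : ∀ y ∈ Ico 0 T,
      Tendsto (Ψ y) (𝓝[>] y) (𝓝 (rightCorrection G G₁ G₂ u₁ u₂ y)) := fun y hy => by
    rw [hright]
    refine (((hlimR G hGcont y hy).2.sub_const _).sub (Tendsto.const_mul _ ?_)).sub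
      (Tendsto.const_mul _ ?_)
    · exact (tendsto_rightLim_of_tendsto (hreg₁.2 y hy)).sub_const _
    · exact (tendsto_rightLim_of_tendsto (hreg₂.2 y hy)).sub_const _
  -- Away from finitely many points, `u` stays close to `u y`, where `G₂` varies little.
  have hloc : ∀ ε > 0, ∃ F : Set ℝ, F.Finite ∧ ∀ y ∈ Icc 0 T, y ∉ F → ∀ᶠ s in 𝓝[Icc 0 T] y,
      |Ψ y s| ≤ K₁ * (u₁ s - u₁ y) ^ 2 + ε * |V s - V y| := by
    intro ε hε
    obtain ⟨d, hd, hd'⟩ := Metric.uniformContinuousOn_iff.1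
      ((hc₁.prod hc₂).uniformContinuousOn_of_continuous hG.continuousOn₂) ε hε
    obtain ⟨F₁, hF₁, h₁⟩ := hreg₁.exists_finite hd
    obtain ⟨F₂, hF₂, h₂⟩ := hreg₂.exists_finite hd
    refine ⟨F₁ ∪ F₂, hF₁.union hF₂, fun y hy hyF => ?_⟩
    rw [mem_union, not_or] at hyF
    filter_upwards [h₁ y hy hyF.1, h₂ y hy hyF.2, self_mem_nhdsWithin] with s hs₁ hs₂ hsI
    refine (hG.abs_taylorRemainder_le hK₁ hLip (hmem y hy) (hmem s hsI) (D := ε)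
      fun z hz => ?_).trans ?_
    · have hzd : |z - u₂ y| < d := (abs_sub_left_of_mem_uIcc hz).trans_lt hs₂
      refine (hd' (u₁ s, z) ⟨(hmem s hsI).1, OrdConnected.uIcc_subset ‹_› (hmem y hy).2
        (hmem s hsI).2 hz⟩ _ (hmem y hy) ?_).le
      rw [Prod.dist_eq]
      exact max_lt hs₁ hzd
    · exact add_le_add le_rfl (mul_le_mul_of_nonneg_left
        (abs_sub_le_abs_variation_sub hT.le hu₂ hsI hy) hε.le)
  obtain ⟨δ₁, hδ₁, hδ₁τ⟩ := exists_gauge_abs_sum_sub_lt (V := V) hT.le hu₁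
    ((variationOnFromTo.monotoneOn (boundedVariationOn_constExtend hT.le
      hu₂).locallyBoundedVariationOn (mem_univ 0)).mono (subset_univ _)) hK₁
    (Ψ := Ψ) (fun y => by simp [hΨ, taylorRemainder]) hremL hremR hsumL.of_abs hsumR.of_abs hloc
    (half_pos hε)
  obtain ⟨δ₂, hδ₂, hδ₂τ⟩ := hHK₂ (ε / 2) (half_pos hε)
  refine ⟨fun s => min (δ₁ s) (δ₂ s), fun s hs => lt_min (hδ₁ s hs) (hδ₂ s hs), fun τ hτ => ?_⟩
  have h₁ := hδ₁τ τ (hτ.mono fun _ => min_le_left _ _)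
  have h₂ := hδ₂τ τ (hτ.mono fun _ => min_le_right _ _)
  have htel := Finset.sum_range_sub (fun i => G (u₁ (τ.pt i), u₂ (τ.pt i))) τ.n
  rw [τ.pt_zero, τ.pt_last] at htel
  -- The increments of `G ∘ u` telescope, the linear parts add up to the two Riemann sums.
  have hsum : ∑ i ∈ Finset.range τ.n, (Ψ (τ.tag i) (τ.pt (i + 1)) - Ψ (τ.tag i) (τ.pt i)) =
      G (u₁ T, u₂ T) - G (u₁ 0, u₂ 0) - riemannSum (fun s => G₁ (u₁ s, u₂ s)) u₁ τ -
        riemannSum (fun s => G₂ (u₁ s, u₂ s)) u₂ τ := by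
    rw [← htel, riemannSum, riemannSum, ← Finset.sum_sub_distrib, ← Finset.sum_sub_distrib]
    exact Finset.sum_congr rfl fun i _ => by simp only [hΨ, taylorRemainder]; ring
  rw [hsum] at h₁
  have h₁' := abs_lt.1 h₁
  have h₂' := abs_lt.1 h₂
  exact abs_lt.2 ⟨by linarith [h₁'.2, h₂'.2], by linarith [h₁'.1, h₂'.1]⟩
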